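/- Let $p_0,p_1,\dots$ be points of $\mathbb R^3$, let $e_a$ be the edge from $p_a$ to $p_{a+1}$, and put $p_{a,b}=p_b-p_a$. Let $\epsilon_{a,b}=\operatorname{sign}\big(((p_{a+1}-p_a)\times(p_{b+1}-p_b))\cdot(p_a-p_b)\big)$ be the sign of the crossing of $e_a$ and $e_b$. Let $i,j$ be such that $\epsilon_{i,j}\ne 0$ and $\epsilon_{i,j+1}\neq 0$ (that is, neither $e_i,e_j$ nor $e_i,e_{j+1}$ are coplanar). Let $Q_{a,b}\subset S^2$ be the set of the directions of the vectors $x-y$ with $x$ in the interior of $e_a$ and $y$ in the interior of $e_b$, let $Q^A$ denote the antipodal image of $Q\subset S^2$, and let $Q_{i,j,j+1}=(Q_{i,j}\cap Q_{i,j+1})\cup(Q_{i,j}^A\cap Q_{i,j+1})$. Let $A$ be area on the unit sphere. Say that the projections of two edges along $\xi\in S^2$ cross if the orthogonal projections to the plane $\xi^\perp$ of some interior point of the one and of some interior point of the other coincide. With $r_{a,b}=p_a-p_b$, let $n_1,n_2,n_3,n_4$ be the unit vectors in the directions of $r_{i,j}\times r_{i,j+1}$, $r_{i,j+1}\times r_{i+1,j+1}$,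 $r_{i+1,j+1}\times r_{i+1,j}$, $r_{i+1,j}\times r_{i,j}$, and let $u_1,u_2,u_3,u_4$ be the same vectors with $j$ replaced by $j+1$. Let $v_3=p_{j,j+2}\times p_{j+1,j+2}$ and $$w=(u_2\times(-n_2))\cdot(u_2\times n_4),\qquad w_0=(v_3\times(-n_1))\cdot(v_3\times n_3).$$ For unit vectors $w_1,\dots,w_k$ let $(w_1,\dots,w_k)$ denote the non-empty (open) spherical polygon that is the intersection of the hemispheres bounded by the great circles with normal vectors $w_1,\dots,w_k$, where these vectors point either all inward or all outward, and where the choice between these two antipodal regions is the one for which the great circles, in the listed order, run counterclockwise around the polygon as seen from outside the sphere (a listed great circle may turn out to carry no side of the polygon; the order then refers to the others). Let $P=Q_{i,j,j+1}$ if $\epsilon_{i,j}=-1$ and $P=Q_{i,j,j+1}^A$ if $\epsilon_{i,j}=1$. **Theorem.** The joint probability, for a uniformly random direction $\xi\in S^2$, that the projections of $e_i$ and $e_j$ cross and the projections of $e_i$ and $e_{j+1}$ cross equals $\frac1{2\pi}A(Q_{i,j,j+1})$. Moreover $A(P)=A(Q_{i,j,j+1})$, and the polygon is determined as follows. (a)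 Suppose $\epsilon_{i,j}=\epsilon_{i,j+1}$, $w<0$ and $w_0<0$. Put $c_{j+1,i+1}=(p_{j+1,i+1}\cdot n_1)\epsilon_{i,j}$, $c_{j+2,i+1}=(p_{j+2,i+1}\cdot n_1)\epsilon_{i,j}$, $c_{j+1,i}=(p_{j+1,i}\cdot n_3)\epsilon_{i,j}$, $c_{j+2,i}=(p_{j+2,i}\cdot n_3)\epsilon_{i,j}$. Then $P=(n_4,L,-u_2,R)$, where $L$ is $n_1$; $-u_3$; $n_1,-u_3$; $-u_3,n_1$ according as the signs of $(c_{j+1,i+1},c_{j+2,i+1})$ are $(+,+)$; $(-,-)$; $(+,-)$; $(-,+)$, and $R$ is $n_3$; $-u_1$; $-u_1,n_3$; $n_3,-u_1$ according as the signs of $(c_{j+1,i},c_{j+2,i})$ are $(+,+)$; $(-,-)$; $(+,-)$; $(-,+)$ (sixteen cases). (b) If $\epsilon_{i,j}=\epsilon_{i,j+1}$ and ($w>0$ or $w_0>0$), then $Q_{i,j,j+1}=\emptyset$. (c) Suppose $\epsilon_{i,j}=-\epsilon_{i,j+1}$. Put $c'_{j+2,i}=(p_{j+2,i}\cdot n_1)\epsilon_{i,j}$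 and $c'_{j+2,i+1}=(p_{j+2,i+1}\cdot n_3)\epsilon_{i,j}$. If $w<0$ (respectively $w>0$), then $P=(n_2,X,-u_2,Y)$ (respectively $P=(n_2,X,n_4,Y)$), where $X$ is $-u_1$ if $c'_{j+2,i}>0$ and $n_1$ if $c'_{j+2,i}<0$, and $Y$ is $-u_3$ if $c'_{j+2,i+1}>0$ and $n_3$ if $c'_{j+2,i+1}<0$ (eight cases). -/

import Mathlib

open MeasureTheory
open scoped RealInnerProductSpace

noncomputable section

namespace PolygonalChain

/-- Euclidean 3-space. -/
abbrev E3 : Type := EuclideanSpace ℝ (Fin 3)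

/-- The unit sphere of directions. -/
abbrev S2 : Type := Metric.sphere (0 : E3) 1

/-- The vector product of Euclidean 3-space. -/
def cross (a b : E3) : E3 := WithLp.toLp 2 (crossProduct (WithLp.ofLp a) (WithLp.ofLp b))

/-- The scalar triple product `(a × b) · c`. -/
def triple (a b c : E3) : ℝ := ⟪cross a b, c⟫

/-- The vector divided by its length. -/
def unit (v : E3) : E3 := (‖v‖⁻¹ : ℝ) • v

/-- Area on the unit sphere. -/
def area (S : Set S2) : ℝ := (volume : Measure E3).toSphere.real S

/-- The probability that a random direction lies in `S`: the ratio of the area of `S` over the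
area of the entire sphere. -/
def directionProbability (S : Set S2) : ℝ := area S / area Set.univ

/-- The orthogonal projection onto the plane through the origin with normal vector `ξ`. -/
def planeProjection (ξ : S2) (x : E3) : E3 := (Submodule.span ℝ {(ξ : E3)})ᗮ.starProjection x

/-- The image of a set of directions under the antipodal map. -/
def antipode (S : Set S2) : Set S2 := {ξ | -ξ ∈ S}

/-! ### Edges of a chain with vertices `p 0, p 1, …`; the edge `e_i` joins `p i` to `p (i + 1)` -/

/-- The edge `e_i` without its end points. -/
def edge (p : ℕ → E3) (i : ℕ) : Set E3 := openSegment ℝ (p i) (p (i + 1))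

/-- The projections of `e_i` and `e_j` to the plane with normal vector `ξ` cross: some point in the
interior of the one edge and some point in the interior of the other have the same image. -/
def ProjectionsCross (p : ℕ → E3) (i j : ℕ) (ξ : S2) : Prop :=
  ∃ x ∈ edge p i, ∃ y ∈ edge p j, planeProjection ξ x = planeProjection ξ y

/-- The vector that connects vertex `a` to vertex `b`. -/
def vec (p : ℕ → E3) (a b : ℕ) : E3 := p b - p a

/-- The sign `ε_{i,j}` of the crossing of `e_i` and `e_j`, which is the sign of the (constant)
numerator in the Gauss linking integral of the two edges. It is `0` exactly when the four end
points are coplanar. -/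
def crossingSign (p : ℕ → E3) (i j : ℕ) : ℝ :=
  Real.sign (triple (p (i + 1) - p i) (p (j + 1) - p j) (p i - p j))

/-- `Q_{i,j}`: the directions that point from a point of `e_j` to a point of `e_i`. For edges that
are not coplanar it is the interior of the spherical quadrangle whose corners are the directions
of `p a - p b` with `a = i, i + 1` and `b = j, j + 1`.The projections of `e_i` and `e_j` along such a
direction, or along its opposite, cross. -/
def Q (p : ℕ → E3) (i j : ℕ) : Set S2 :=
  {ξ | ∃ x ∈ edge p i, ∃ y ∈ edge p j, ∃ t : ℝ, 0 < t ∧ x - y = t • (ξ : E3)}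

/-- `Q_{i,j,k} = (Q_{i,j} ∩ Q_{i,k}) ∪ (Q_{i,j}^A ∩ Q_{i,k})`. -/
def Q₃ (p : ℕ → E3) (i j k : ℕ) : Set S2 :=
  (Q p i j ∩ Q p i k) ∪ (antipode (Q p i j) ∩ Q p i k)

/-- `Q_{i,j,k}` if `ε_{i,j} = -1`, and its antipodal `Q_{i,j,k}^A` otherwise. (The antipodal map
reverses orientation, so a list of great circles that runs counterclockwise around one of the two
runs clockwise around the other; the sign of `ε_{i,j}` decides between them.) -/
def Q₃signed (p : ℕ → E3) (i j k : ℕ) : Set S2 :=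
  if crossingSign p i j = -1 then Q₃ p i j k else antipode (Q₃ p i j k)

/-! ### The unit normal vectors of the faces of the tetrahedron spanned by `e_i` and `e_j` -/

/-- Normal vector to the face with vertices `i, j, j + 1`. -/
def normal₁ (p : ℕ → E3) (i j : ℕ) : E3 :=
  unit (cross (p i - p j) (p i - p (j + 1)))

/-- Normal vector to the face with vertices `i, i + 1, j + 1`. -/
def normal₂ (p : ℕ → E3) (i j : ℕ) : E3 :=
  unit (cross (p i - p (j + 1)) (p (i + 1) - p (j + 1)))

/-- Normal vector to the face with vertices `i + 1, j, j + 1`. -/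
def normal₃ (p : ℕ → E3) (i j : ℕ) : E3 :=
  unit (cross (p (i + 1) - p (j + 1)) (p (i + 1) - p j))

/-- Normal vector to the face with vertices `i, i + 1, j`. -/
def normal₄ (p : ℕ → E3) (i j : ℕ) : E3 :=
  unit (cross (p (i + 1) - p j) (p i - p j))

/-! ### Spherical polygons -/

/-- The intersection of the open hemispheres with inward normal vectors `ws`. -/
def hemispheres (ws : List E3) : Set S2 := {ξ | ∀ w ∈ ws, 0 < ⟪w, (ξ : E3)⟫}

/-- The great circle with normal vector `w` carries a side of the polygon `hemispheres ws`: it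
contains a point that is strictly inside all the other hemispheres. -/
def IsSide (ws : List E3) (w : E3) : Prop :=
  ∃ ξ : S2, ⟪w, (ξ : E3)⟫ = 0 ∧ ∀ v ∈ ws, v ≠ w → 0 < ⟪v, (ξ : E3)⟫

/-- The inward normal vectors `ws` list the sides of the polygon `hemispheres ws` in the
counterclockwise order, seen from outside the sphere. (For the inward normal vectors of the sides
of a convex spherical polygon this cyclic order is detected by the triple products. A great circle
in the list that carries no side has no place in the order.) -/
def IsCounterclockwise (ws : List E3) : Prop :=
  ws.Triplewise fun a b c => IsSide ws a → IsSide ws b → IsSide ws c → 0 ≤ triple a b c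

/-- `P` is the spherical polygon `(w_1, …, w_k)` bounded by the great circles with normal vectors
`w_1, …, w_k` in the counterclockwise orientation, the vectors pointing all inward or all
outward. -/
def IsSphericalPolygon (ws : List E3) (P : Set S2) : Prop :=
  P.Nonempty ∧
    ((P = hemispheres ws ∧ IsCounterclockwise ws) ∨
      (P = hemispheres (ws.map fun w => -w) ∧ IsCounterclockwise (ws.map fun w => -w)))

end PolygonalChain

end

noncomputable section

namespace PolygonalChain

/-! Everything becomes linear in one affine frame: origin at the common vertex `p (j + 1)` of $e_j$
and $e_{j+1}$, axes $a, b, c$ towards `p i`, `p (i + 1)`, `p j`, and last vertex $p_{j+2} = p_{j+1}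
+ \alpha a + \beta b + \gamma c$. Write $X, Y, Z$ for the dual coordinates of a direction. Then
$Q_{i,j}$ is cut out by $X, Y > 0$, $Z < 0$, $X + Y + Z > 0$, and $Q_{i,j+1}$ by the same
inequalities in the frame whose third axis points to $p_{j+2}$.

All face normals are positive multiples of explicit functionals in $X, Y, Z$, and all signs in the
theorem are signs of polynomials in $\alpha, \beta, \gamma$: the crossing signs agree iff $\gamma <
0$, $w$ has the sign of $\gamma(\alpha + \beta + \gamma - 1)$, $w_0$ that of $-\alpha\beta$, and the
$c$'s compare $\alpha$ and $\beta$ with $1$ or $0$. These signs decide which of the seven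
inequalities defining $P$ (`Frame.mem_Q₃signed_of_pos`, `Frame.mem_Q₃signed_of_neg`) are implied by
the others. The remaining ones are the listed great circles, and $3 \times 3$ determinants give
their cyclic order (`isCounterclockwise_four`, `isCounterclockwise_six`).

For the probability, both pairs cross along $\xi$ exactly when $\xi$ lies in $Q_{i,j,j+1}$ or its
antipode. These are disjoint of equal area, whence $2A/4\pi$. -/

theorem mul_neg_iff_of_pos_left {s r : ℝ} (hs : 0 < s) : s * r < 0 ↔ r < 0 := by
  rw [← neg_pos, ← mul_neg, mul_pos_iff_of_pos_left hs, neg_pos]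

/-! ### Coordinates, triple products and the dual basis. -/

theorem cross_apply_zero (a b : E3) : cross a b 0 = a 1 * b 2 - a 2 * b 1 := by
  simp [cross, crossProduct]

theorem cross_apply_one (a b : E3) : cross a b 1 = a 2 * b 0 - a 0 * b 2 := by
  simp [cross, crossProduct]

theorem cross_apply_two (a b : E3) : cross a b 2 = a 0 * b 1 - a 1 * b 0 := by
  simp [cross, crossProduct]

theorem inner_eq_coord (a b : E3) : ⟪a, b⟫ = a 0 * b 0 + a 1 * b 1 + a 2 * b 2 := by
  simp [PiLp.inner_apply, Fin.sum_univ_three]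
  ring

theorem E3.ext {a b : E3} (h₀ : a 0 = b 0) (h₁ : a 1 = b 1) (h₂ : a 2 = b 2) : a = b := by
  ext i
  fin_cases i
  exacts [h₀, h₁, h₂]

/-- The linear combination of the vectors of the (unnormalized) dual basis of `a`, `b`, `c`. -/
def comb (a b c : E3) (x y z : ℝ) : E3 := x • cross b c + y • cross c a + z • cross a b

theorem triple_eq_coord (a b c : E3) : triple a b c =
    (a 1 * b 2 - a 2 * b 1) * c 0 + (a 2 * b 0 - a 0 * b 2) * c 1
      + (a 0 * b 1 - a 1 * b 0) * c 2 := by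
  simp [triple, inner_eq_coord, cross_apply_zero, cross_apply_one, cross_apply_two]

theorem inner_comb (a b c : E3) (x y z : ℝ) (v : E3) : ⟪comb a b c x y z, v⟫ =
    x * ⟪cross b c, v⟫ + y * ⟪cross c a, v⟫ + z * ⟪cross a b, v⟫ := by
  simp [comb, inner_add_left, real_inner_smul_left]

theorem inner_comb_frame (a b c : E3) (x y z X Y Z : ℝ) :
    ⟪comb a b c x y z, X • a + Y • b + Z • c⟫ = triple a b c * (x * X + y * Y + z * Z) := by
  simp [comb, triple_eq_coord, inner_eq_coord, cross_apply_zero, cross_apply_one, cross_apply_two]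
  ring

theorem cross_comb (a b c : E3) (x y z x' y' z' : ℝ) :
    cross (comb a b c x y z) (comb a b c x' y' z') =
      (triple a b c * (y * z' - z * y')) • a + (triple a b c * (z * x' - x * z')) • b
        + (triple a b c * (x * y' - y * x')) • c := by
  apply E3.ext <;>
  · simp [comb, triple_eq_coord, cross_apply_zero, cross_apply_one, cross_apply_two]
    ring

/-- Up to a positive square, the triple product of dual vectors is the determinant of their
coefficients, so orientation questions no longer depend on the frame. -/
theorem triple_comb (a b c : E3) (x y z x' y' z' x'' y'' z'' : ℝ) :
    triple (comb a b c x y z) (comb a b c x' y' z') (comb a b c x'' y'' z'') =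
      triple a b c ^ 2 * ((y * z' - z * y') * x'' + (z * x' - x * z') * y''
        + (x * y' - y * x') * z'') := by
  rw [triple, cross_comb, real_inner_comm, inner_comb_frame]
  ring

theorem neg_comb (a b c : E3) (x y z : ℝ) :
    -comb a b c x y z = comb a b c (-x) (-y) (-z) := by
  simp [comb]; abel

theorem comb_ne_zero {a b c : E3} (h : triple a b c ≠ 0) {x y z : ℝ}
    (hxyz : x ^ 2 + y ^ 2 + z ^ 2 ≠ 0) : comb a b c x y z ≠ 0 := by
  intro h0
  have := inner_comb_frame a b c x y z x y z
  rw [h0, inner_zero_left] at this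
  rcases mul_eq_zero.1 this.symm with h1 | h1
  · exact h h1
  · exact hxyz (by linarith)

theorem exists_unit_comb {a b c : E3} (h : triple a b c ≠ 0) {x y z : ℝ}
    (hxyz : x ^ 2 + y ^ 2 + z ^ 2 ≠ 0) :
    ∃ k : ℝ, 0 < k ∧ unit (comb a b c x y z) = k • comb a b c x y z :=
  ⟨_, inv_pos.2 (norm_pos_iff.2 (comb_ne_zero h hxyz)), rfl⟩

theorem exists_frame_coord {a b c : E3} (h : triple a b c ≠ 0) (v : E3) :
    ∃ x y z : ℝ, v = x • a + y • b + z • c := by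
  refine ⟨⟪cross b c, v⟫ / triple a b c, ⟪cross c a, v⟫ / triple a b c,
    ⟪cross a b, v⟫ / triple a b c, ?_⟩
  have key : triple a b c • v = ⟪cross b c, v⟫ • a + ⟪cross c a, v⟫ • b + ⟪cross a b, v⟫ • c := by
    apply E3.ext <;>
    · simp [triple_eq_coord, inner_eq_coord, cross_apply_zero, cross_apply_one, cross_apply_two]
      ring
  rw [← smul_right_injective E3 h |>.eq_iff, key]
  simp only [smul_add, smul_smul, mul_div_cancel₀ _ h]

theorem frame_coord_unique {a b c : E3} (h : triple a b c ≠ 0) {x y z x' y' z' : ℝ}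
    (he : x • a + y • b + z • c = x' • a + y' • b + z' • c) : x = x' ∧ y = y' ∧ z = z' := by
  have h1 := inner_comb_frame a b c (x - x') (y - y') (z - z') x y z
  rw [he, inner_comb_frame] at h1
  have h2 := mul_left_cancel₀ h h1
  have h3 : (x - x') ^ 2 + (y - y') ^ 2 + (z - z') ^ 2 = 0 := by linarith
  refine ⟨?_, ?_, ?_⟩ <;> nlinarith [sq_nonneg (x - x'), sq_nonneg (y - y'), sq_nonneg (z - z')]

/-! ### The affine frame, crossing signs and face normals. -/

/-- The five vertices of the edges `e_i`, `e_j`, `e_{j+1}` in the affine frame with origin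
`p (j + 1)` and axes towards `p i`, `p (i + 1)` and `p j`. -/
structure Frame (p : ℕ → E3) (i j : ℕ) where
  a : E3
  b : E3
  c : E3
  α : ℝ
  β : ℝ
  γ : ℝ
  ha : p i = p (j + 1) + a
  hb : p (i + 1) = p (j + 1) + b
  hc : p j = p (j + 1) + c
  he : p (j + 2) = p (j + 1) + (α • a + β • b + γ • c)
  vol : triple a b c ≠ 0
  hγ : γ ≠ 0

section

variable {p : ℕ → E3} {i j : ℕ}

theorem crossingSign_eq_sign_triple : crossingSign p i j =
    Real.sign (-triple (p i - p (j + 1)) (p (i + 1) - p (j + 1)) (p j - p (j + 1))) := by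
  unfold crossingSign
  congr 1
  simp [triple_eq_coord]
  ring

namespace Frame

variable (F : Frame p i j)

theorem crossingSign_eq : crossingSign p i j = Real.sign (-triple F.a F.b F.c) := by
  rw [crossingSign_eq_sign_triple, F.ha, F.hb, F.hc]
  simp

theorem crossingSign_succ_eq : crossingSign p i (j + 1) = Real.sign (F.γ * triple F.a F.b F.c) := by
  unfold crossingSign
  rw [show j + 1 + 1 = j + 2 from rfl, F.ha, F.hb, F.he]
  congr 1
  simp [triple_eq_coord]
  ring

end Frame

theorem exists_frame (h : crossingSign p i j ≠ 0) (h' : crossingSign p i (j + 1) ≠ 0) :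
    Nonempty (Frame p i j) := by
  have vol : triple (p i - p (j + 1)) (p (i + 1) - p (j + 1)) (p j - p (j + 1)) ≠ 0 := by
    intro h0
    rw [crossingSign_eq_sign_triple, h0] at h
    simp at h
  obtain ⟨α, β, γ, he⟩ := exists_frame_coord vol (p (j + 2) - p (j + 1))
  refine ⟨⟨_, _, _, α, β, γ, (add_sub_cancel _ _).symm, (add_sub_cancel _ _).symm,
    (add_sub_cancel _ _).symm, by rw [← he]; abel, vol, ?_⟩⟩
  -- If $\gamma = 0$, then `p (j + 2)` lies in the plane of `p (j + 1)`, `p i`, `p (i + 1)`, against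
  -- the second crossing sign being nonzero.
  rintro rfl
  apply h'
  have e : p (j + 2) = p (j + 1) + (α • (p i - p (j + 1)) + β • (p (i + 1) - p (j + 1))) := by
    rw [← sub_eq_iff_eq_add', he]; simp
  unfold crossingSign
  rw [show j + 1 + 1 = j + 2 from rfl, e, Real.sign_eq_zero_iff]
  simp [triple_eq_coord]
  ring

namespace Frame

variable (F : Frame p i j)

/-- As a functional, each face normal vanishes on the directions in its face, which fixes its dual
coefficients up to scale. Only positivity of the factor matters later. -/
theorem normal₁_eq : ∃ k : ℝ, 0 < k ∧ normal₁ p i j = k • comb F.a F.b F.c 0 (-1) 0 := by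
  obtain ⟨k, hk, h⟩ := exists_unit_comb (a := F.a) (b := F.b) (c := F.c)
    (x := 0) (y := (-1)) (z := 0) F.vol (by norm_num)
  refine ⟨k, hk, h ▸ ?_⟩
  rw [normal₁, F.ha, F.hc]
  congr 1
  apply E3.ext <;>
  · simp [comb, cross_apply_zero, cross_apply_one, cross_apply_two]
    ring

theorem normal₂_eq : ∃ k : ℝ, 0 < k ∧ normal₂ p i j = k • comb F.a F.b F.c 0 0 1 := by
  obtain ⟨k, hk, h⟩ := exists_unit_comb (a := F.a) (b := F.b) (c := F.c)
    (x := 0) (y := 0) (z := 1) F.vol (by norm_num)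
  refine ⟨k, hk, h ▸ ?_⟩
  rw [normal₂, F.ha, F.hb]
  congr 1
  apply E3.ext <;>
  · simp [comb, cross_apply_zero, cross_apply_one, cross_apply_two]

theorem normal₃_eq : ∃ k : ℝ, 0 < k ∧ normal₃ p i j = k • comb F.a F.b F.c (-1) 0 0 := by
  obtain ⟨k, hk, h⟩ := exists_unit_comb (a := F.a) (b := F.b) (c := F.c)
    (x := (-1)) (y := 0) (z := 0) F.vol (by norm_num)
  refine ⟨k, hk, h ▸ ?_⟩
  rw [normal₃, F.hb, F.hc]
  congr 1
  apply E3.ext <;>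
  · simp [comb, cross_apply_zero, cross_apply_one, cross_apply_two]
    ring

theorem normal₄_eq : ∃ k : ℝ, 0 < k ∧ normal₄ p i j = k • comb F.a F.b F.c (-1) (-1) (-1) := by
  obtain ⟨k, hk, h⟩ := exists_unit_comb (a := F.a) (b := F.b) (c := F.c)
    (x := (-1)) (y := (-1)) (z := (-1)) F.vol (by norm_num)
  refine ⟨k, hk, h ▸ ?_⟩
  rw [normal₄, F.ha, F.hb, F.hc]
  congr 1
  apply E3.ext <;>
  · simp [comb, cross_apply_zero, cross_apply_one, cross_apply_two]
    ring

theorem normal₁_succ_eq : ∃ k : ℝ, 0 < k ∧ normal₁ p i (j + 1) = k • comb F.a F.b F.c 0 F.γ (-F.β) := by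
  obtain ⟨k, hk, h⟩ := exists_unit_comb (a := F.a) (b := F.b) (c := F.c)
    (x := 0) (y := F.γ) (z := (-F.β)) F.vol (by
    have := F.hγ
    positivity)
  refine ⟨k, hk, h ▸ ?_⟩
  rw [normal₁, show j + 1 + 1 = j + 2 from rfl, F.ha, F.he]
  congr 1
  apply E3.ext <;>
  · simp [comb, cross_apply_zero, cross_apply_one, cross_apply_two]
    ring

theorem normal₂_succ_eq : ∃ k : ℝ, 0 < k ∧ normal₂ p i (j + 1) = k • comb F.a F.b F.c F.γ F.γ (1 - F.α - F.β) := by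
  obtain ⟨k, hk, h⟩ := exists_unit_comb (a := F.a) (b := F.b) (c := F.c)
    (x := F.γ) (y := F.γ) (z := (1 - F.α - F.β)) F.vol (by
    have := F.hγ
    positivity)
  refine ⟨k, hk, h ▸ ?_⟩
  rw [normal₂, show j + 1 + 1 = j + 2 from rfl, F.ha, F.hb, F.he]
  congr 1
  apply E3.ext <;>
  · simp [comb, cross_apply_zero, cross_apply_one, cross_apply_two]
    ring

theorem normal₃_succ_eq : ∃ k : ℝ, 0 < k ∧ normal₃ p i (j + 1) = k • comb F.a F.b F.c F.γ 0 (-F.α) := by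
  obtain ⟨k, hk, h⟩ := exists_unit_comb (a := F.a) (b := F.b) (c := F.c)
    (x := F.γ) (y := 0) (z := (-F.α)) F.vol (by
    have := F.hγ
    positivity)
  refine ⟨k, hk, h ▸ ?_⟩
  rw [normal₃, show j + 1 + 1 = j + 2 from rfl, F.hb, F.he]
  congr 1
  apply E3.ext <;>
  · simp [comb, cross_apply_zero, cross_apply_one, cross_apply_two]
    ring

end Frame
end

/-! ### Area -/

theorem volume_antipode (S : Set S2) (hS : MeasurableSet S) :
    (volume : Measure E3).toSphere (antipode S) = (volume : Measure E3).toSphere S := by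
  have hS' : MeasurableSet (antipode S) := hS.preimage measurable_neg
  rw [Measure.toSphere_apply' _ hS, Measure.toSphere_apply' _ hS']
  have : ((↑) '' antipode S : Set E3) = -((↑) '' S) := by
    ext x
    constructor
    · rintro ⟨ξ, hξ, rfl⟩
      exact ⟨-ξ, hξ, rfl⟩
    · rintro ⟨ξ, hξ, h⟩
      exact ⟨-ξ, by simpa [antipode] using hξ, by simp [h]⟩
  rw [this, Set.smul_neg, Measure.measure_neg]

theorem area_antipode {S : Set S2} (hS : MeasurableSet S) : area (antipode S) = area S := by
  simp only [area, measureReal_def, volume_antipode S hS]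

theorem area_univ : area Set.univ = 4 * Real.pi := by
  rw [area, Measure.toSphere_real_apply_univ, measureReal_def, EuclideanSpace.volume_ball_fin_three]
  have : (0 : ℝ) ≤ Real.pi * 4 / 3 := by positivity
  simp [this]
  ring

theorem area_union_antipode {S : Set S2} (hS : MeasurableSet S) (hd : Disjoint S (antipode S)) :
    area (S ∪ antipode S) = 2 * area S := by
  rw [area, measureReal_union hd (hS.preimage measurable_neg), ← area, ← area, area_antipode hS]
  ring

/-! ### Directions -/

/-- A difference $u - v$ has coordinates $(s_1, s_2, -t_2)$ with $s_1 + s_2 = 1$ and $0 < t_2 < 1$.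
Conversely, dividing by $x + y$ normalizes the first two coordinates to sum $1$. -/
theorem exists_sub_eq_smul_iff {a b c : E3} (h : triple a b c ≠ 0) (D : E3) (x y z : ℝ) :
    (∃ u ∈ openSegment ℝ (D + a) (D + b), ∃ v ∈ openSegment ℝ D (D + c), ∃ t : ℝ, 0 < t ∧
      u - v = t • (x • a + y • b + z • c)) ↔ 0 < x ∧ 0 < y ∧ z < 0 ∧ 0 < x + y + z := by
  constructor
  · rintro ⟨_, ⟨s₁, s₂, hs₁, hs₂, hs, rfl⟩, _, ⟨t₁, t₂, ht₁, ht₂, ht', rfl⟩, t, ht, he⟩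
    have he' : s₁ • a + s₂ • b + (-t₂) • c = (t * x) • a + (t * y) • b + (t * z) • c := by
      calc s₁ • a + s₂ • b + (-t₂) • c
          = s₁ • (D + a) + s₂ • (D + b) - (t₁ • D + t₂ • (D + c))
              - ((s₁ + s₂) - (t₁ + t₂)) • D := by module
        _ = _ := by rw [he, hs, ht']; module
    obtain ⟨h1, h2, h3⟩ := frame_coord_unique h he'
    refine ⟨?_, ?_, ?_, ?_⟩
    · exact pos_of_mul_pos_right (h1 ▸ hs₁) ht.le
    · exact pos_of_mul_pos_right (h2 ▸ hs₂) ht.le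
    · nlinarith
    · refine pos_of_mul_pos_right (a := t) ?_ ht.le
      linarith
  · rintro ⟨hx, hy, hz, hs⟩
    have hxy : 0 < x + y := add_pos hx hy
    refine ⟨_, ⟨x / (x + y), y / (x + y), by positivity, by positivity, by field_simp, rfl⟩, _,
      ⟨(x + y + z) / (x + y), -z / (x + y), by positivity,
        div_pos (by linarith) hxy, by field_simp; ring, rfl⟩, (x + y)⁻¹, by positivity, ?_⟩
    have h1 : x / (x + y) + y / (x + y) = (x + y + z) / (x + y) + -z / (x + y) := by
      field_simp; ring
    calc _ = (x / (x + y) + y / (x + y)) • D - ((x + y + z) / (x + y) + -z / (x + y)) • D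
          + (x / (x + y)) • a + (y / (x + y)) • b - (-z / (x + y)) • c := by module
      _ = _ := by
        rw [h1]
        simp only [div_eq_mul_inv]
        module

theorem planeProjection_eq_iff (ξ : S2) (x y : E3) :
    planeProjection ξ x = planeProjection ξ y ↔ ∃ t : ℝ, x - y = t • (ξ : E3) := by
  rw [planeProjection, planeProjection, ← sub_eq_zero, ← map_sub,
    Submodule.starProjection_apply_eq_zero_iff, Submodule.orthogonal_orthogonal,
    Submodule.mem_span_singleton]
  simp only [eq_comm]

section

variable {p : ℕ → E3} {i j : ℕ}

theorem projectionsCross_iff {ξ : S2} (h : Disjoint (edge p i) (edge p j)) :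
    ProjectionsCross p i j ξ ↔ ξ ∈ Q p i j ∨ ξ ∈ antipode (Q p i j) := by
  constructor
  · rintro ⟨x, hx, y, hy, hxy⟩
    obtain ⟨t, ht⟩ := (planeProjection_eq_iff ξ x y).1 hxy
    rcases lt_trichotomy t 0 with h0 | rfl | h0
    · exact Or.inr ⟨x, hx, y, hy, -t, by linarith, by simpa using ht⟩
    · rw [zero_smul, sub_eq_zero] at ht
      exact (Set.disjoint_left.1 h hx (ht ▸ hy)).elim
    · exact Or.inl ⟨x, hx, y, hy, t, h0, ht⟩
  · rintro (⟨x, hx, y, hy, t, -, ht⟩ | ⟨x, hx, y, hy, t, -, ht⟩)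
    · exact ⟨x, hx, y, hy, (planeProjection_eq_iff ξ x y).2 ⟨t, ht⟩⟩
    · exact ⟨x, hx, y, hy, (planeProjection_eq_iff ξ x y).2 ⟨-t, by simpa using ht⟩⟩

/-- A common point would make `p i - p j` a combination of the two edge vectors. Disjointness
excludes the degenerate factor $t = 0$ in `projectionsCross_iff`. -/
theorem disjoint_edge (h : crossingSign p i j ≠ 0) : Disjoint (edge p i) (edge p j) := by
  rw [Set.disjoint_left]
  rintro _ ⟨s₁, s₂, hs₁, hs₂, hs, rfl⟩ ⟨t₁, t₂, ht₁, ht₂, ht, he⟩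
  apply h
  rw [crossingSign, Real.sign_eq_zero_iff]
  have e : p i - p j = t₂ • (p (j + 1) - p j) - s₂ • (p (i + 1) - p i) := by
    calc p i - p j = (s₁ • p i + s₂ • p (i + 1)) - (t₁ • p j + t₂ • p (j + 1))
          + (1 - (s₁ + s₂)) • p i - (1 - (t₁ + t₂)) • p j
          + t₂ • (p (j + 1) - p j) - s₂ • (p (i + 1) - p i) := by module
      _ = _ := by rw [he, hs, ht]; module
  rw [e]
  generalize p (j + 1) - p j = u
  generalize p (i + 1) - p i = v
  simp [triple_eq_coord]
  ring

namespace Frame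

variable (F : Frame p i j)

theorem mem_Q {ξ : S2} {x y z : ℝ} (hξ : (ξ : E3) = x • F.a + y • F.b + z • F.c) :
    ξ ∈ Q p i j ↔ 0 < x ∧ 0 < y ∧ z < 0 ∧ 0 < x + y + z := by
  rw [← exists_sub_eq_smul_iff F.vol (p (j + 1)), ← F.ha, ← F.hb, ← F.hc, ← hξ,
    openSegment_symm ℝ (p (j + 1))]
  rfl

/-- Both $e_j$ and $e_{j+1}$ start at `p (j + 1)`, so the same criterion applies after replacing the
third axis by $\alpha a + \beta b + \gamma c$; the third coordinate becomes $z/\gamma$. -/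
theorem mem_Q_succ {ξ : S2} {x y z : ℝ} (hξ : (ξ : E3) = x • F.a + y • F.b + z • F.c) :
    ξ ∈ Q p i (j + 1) ↔ 0 < x - z / F.γ * F.α ∧ 0 < y - z / F.γ * F.β ∧ z / F.γ < 0 ∧
      0 < x - z / F.γ * F.α + (y - z / F.γ * F.β) + z / F.γ := by
  have h : triple F.a F.b (F.α • F.a + F.β • F.b + F.γ • F.c) ≠ 0 := by
    convert mul_ne_zero F.hγ F.vol using 1
    simp [triple_eq_coord]
    ring
  have hξ' : (ξ : E3) = (x - z / F.γ * F.α) • F.a + (y - z / F.γ * F.β) • F.b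
      + (z / F.γ) • (F.α • F.a + F.β • F.b + F.γ • F.c) := by
    rw [hξ]
    have : z = z / F.γ * F.γ := by field_simp [F.hγ]
    nth_rewrite 1 [this]
    module
  rw [← exists_sub_eq_smul_iff h (p (j + 1)), ← F.ha, ← F.hb, ← F.he, ← hξ']
  rfl

end Frame
end

theorem exists_coord_eq {a b c : E3} (h : triple a b c ≠ 0) {X Y Z : ℝ} (hZ : Z ≠ 0) :
    ∃ (ξ : S2) (k : ℝ), 0 < k ∧ ⟪cross b c, (ξ : E3)⟫ = k * X ∧ ⟪cross c a, (ξ : E3)⟫ = k * Y ∧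
      ⟪cross a b, (ξ : E3)⟫ = k * Z := by
  set v : E3 := (X / triple a b c) • a + (Y / triple a b c) • b + (Z / triple a b c) • c with hv
  have key (x y z : ℝ) : ⟪comb a b c x y z, v⟫ = x * X + y * Y + z * Z := by
    rw [hv, inner_comb_frame]
    field_simp
  have hv0 : v ≠ 0 := by
    intro h0
    have := key 0 0 1
    rw [h0, inner_zero_right] at this
    exact hZ (by linarith)
  have hn : 0 < ‖v‖⁻¹ := inv_pos.2 (norm_pos_iff.2 hv0)
  refine ⟨⟨unit v, by simp [unit, norm_smul, hv0]⟩, ‖v‖⁻¹, hn, ?_, ?_, ?_⟩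
  · simpa [unit, real_inner_smul_right, comb, hn.ne'] using key 1 0 0
  · simpa [unit, real_inner_smul_right, comb, hn.ne'] using key 0 1 0
  · simpa [unit, real_inner_smul_right, comb, hn.ne'] using key 0 0 1

/-! ### Counterclockwise lists -/

theorem triple_smul (k l m : ℝ) (u v w : E3) :
    triple (k • u) (l • v) (m • w) = k * l * m * triple u v w := by
  simp [triple_eq_coord]
  ring

theorem triple_smul_comb_nonneg (a b c : E3) {k l m : ℝ} (hk : 0 < k) (hl : 0 < l) (hm : 0 < m)
    {x y z x' y' z' x'' y'' z'' : ℝ}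
    (h : 0 ≤ (y * z' - z * y') * x'' + (z * x' - x * z') * y'' + (x * y' - y * x') * z'') :
    0 ≤ triple (k • comb a b c x y z) (l • comb a b c x' y' z') (m • comb a b c x'' y'' z'') := by
  rw [triple_smul, triple_comb]
  positivity

theorem triple_self_left (u v : E3) : triple u u v = 0 := by
  simp [triple_eq_coord]; ring

theorem triple_self_right (u v : E3) : triple u v v = 0 := by
  simp [triple_eq_coord]; ring

theorem triple_self_outer (u v : E3) : triple u v u = 0 := by
  simp [triple_eq_coord]; ring

theorem inner_smul_comb_pos {a b c : E3} {k : ℝ} (hk : 0 < k) {x y z : ℝ} {v : E3} :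
    0 < ⟪k • comb a b c x y z, v⟫ ↔
      0 < x * ⟪cross b c, v⟫ + y * ⟪cross c a, v⟫ + z * ⟪cross a b, v⟫ := by
  rw [real_inner_smul_left, inner_comb, mul_pos_iff_of_pos_left hk]

theorem inner_smul_comb_eq_zero {a b c : E3} {k : ℝ} (hk : 0 < k) {x y z : ℝ} {v : E3} :
    ⟪k • comb a b c x y z, v⟫ = 0 ↔
      x * ⟪cross b c, v⟫ + y * ⟪cross c a, v⟫ + z * ⟪cross a b, v⟫ = 0 := by
  rw [real_inner_smul_left, inner_comb, mul_eq_zero, or_iff_right hk.ne']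

theorem smul_comb_inj {a b c : E3} (h : triple a b c ≠ 0) {k l x y z x' y' z' : ℝ}
    (he : k • comb a b c x y z = l • comb a b c x' y' z') :
    k * x = l * x' ∧ k * y = l * y' ∧ k * z = l * z' := by
  have key (X Y Z : ℝ) : k * (x * X + y * Y + z * Z) = l * (x' * X + y' * Y + z' * Z) := by
    have := congrArg (fun v => ⟪v, X • a + Y • b + Z • c⟫) he
    simp only [real_inner_smul_left, inner_comb_frame] at this
    apply mul_left_cancel₀ h
    linarith
  refine ⟨?_, ?_, ?_⟩
  · simpa using key 1 0 0
  · simpa using key 0 1 0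
  · simpa using key 0 0 1

/-- A quadrilateral with one vertex on the great circle of the first side, in which only the third
great circle may fail to carry a side. -/
theorem isCounterclockwise_four {a b c : E3} (h : triple a b c ≠ 0) {k₁ k₂ k₃ k₄ s t r q m l : ℝ}
    (hk₁ : 0 < k₁) (hk₂ : 0 < k₂) (hk₃ : 0 < k₃) (hk₄ : 0 < k₄)
    (hs : 0 < s) (ht : 0 < t) (hr : 0 < r) :
    IsCounterclockwise [k₁ • comb a b c 0 0 (-1), k₂ • comb a b c 0 s q,
      k₃ • comb a b c t t m, k₄ • comb a b c r 0 l] := by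
  simp only [IsCounterclockwise, List.triplewise_cons, List.pairwise_cons, List.mem_cons,
    List.not_mem_nil, or_false, forall_eq_or_imp, forall_eq, List.Pairwise.nil,
    List.Triplewise.nil, IsEmpty.forall_iff, implies_true, and_true]
  have hst := mul_pos hs ht
  have hsr := mul_pos hs hr
  have htr := mul_pos ht hr
  refine ⟨⟨⟨?_, ?_⟩, ?_⟩, ?_⟩
  · rintro - - -
    exact triple_smul_comb_nonneg a b c hk₁ hk₂ hk₃ (by linarith)
  · rintro - - -
    exact triple_smul_comb_nonneg a b c hk₁ hk₂ hk₄ (by linarith)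
  · rintro - - -
    exact triple_smul_comb_nonneg a b c hk₁ hk₃ hk₄ (by linarith)
  · rintro - ⟨ξ, h0, hξ⟩ -
    simp only [List.mem_cons, List.not_mem_nil, or_false, forall_eq_or_imp, forall_eq] at hξ
    obtain ⟨h1, h2, -, h4⟩ := hξ
    -- `IsSide` says nothing about list entries equal to the side's own normal, so coincidences are
    -- split off; there the triple product vanishes.
    by_cases e2 : k₂ • comb a b c 0 s q = k₃ • comb a b c t t m
    · rw [e2, triple_self_left]
    by_cases e4 : k₄ • comb a b c r 0 l = k₃ • comb a b c t t m
    · rw [e4, triple_self_right]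
    have e1 : k₁ • comb a b c 0 0 (-1) ≠ k₃ • comb a b c t t m := fun e => by
      have := (smul_comb_inj h e).1
      have := mul_pos hk₃ ht
      linarith
    have h1 := (inner_smul_comb_pos hk₁).1 (h1 e1)
    have h2 := (inner_smul_comb_pos hk₂).1 (h2 e2)
    have h4 := (inner_smul_comb_pos hk₄).1 (h4 e4)
    have h0 := (inner_smul_comb_eq_zero hk₃).1 h0
    generalize ⟪cross b c, (ξ : E3)⟫ = X at *
    generalize ⟪cross c a, (ξ : E3)⟫ = Y at *
    generalize ⟪cross a b, (ξ : E3)⟫ = Z at *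
    refine triple_smul_comb_nonneg a b c hk₂ hk₃ hk₄ ?_
    have hZ : 0 < -Z := by linarith
    -- Eliminating $X$ and $Y$ from the two inequalities by means of the equation of the third
    -- circle leaves the determinant times $-Z$.
    refine (pos_of_mul_pos_left (b := -Z) ?_ hZ.le).le
    have g2 := mul_pos htr h2
    have g4 := mul_pos hst h4
    have g0 : s * r * (t * X + t * Y + m * Z) = 0 := by rw [h0, mul_zero]
    linarith

section

variable {a b c : E3} {α β g k₁ k₂ k₃ k₄ l₁ l₂ l₃ : ℝ}

/-- The determinant is $\alpha - g$, whose sign is not fixed by the hypotheses. At a point of the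
side, $Y = 0$; eliminating $X$ from the inequalities for the other circles gives $Z > 0$ and then
$(\alpha - g)Z > 0$. -/
theorem triple_nonneg_of_isSide_left (h : triple a b c ≠ 0)
    (hk₁ : 0 < k₁) (hk₄ : 0 < k₄) (hl₂ : 0 < l₂) (hl₃ : 0 < l₃) (hg : 0 < g)
    (hαβ : 1 + g < α + β) {ws : List E3}
    (h₄ : k₄ • comb a b c (-1) (-1) (-1) ∈ ws) (h₃ : l₃ • comb a b c g 0 α ∈ ws)
    (h₂ : l₂ • comb a b c g g (α + β - 1) ∈ ws)
    (hside : IsSide ws (k₁ • comb a b c 0 (-1) 0)) :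
    0 ≤ triple (k₄ • comb a b c (-1) (-1) (-1)) (k₁ • comb a b c 0 (-1) 0)
      (l₃ • comb a b c g 0 α) := by
  obtain ⟨ξ, h0, hξ⟩ := hside
  by_cases e4 : k₄ • comb a b c (-1) (-1) (-1) = k₁ • comb a b c 0 (-1) 0
  · rw [e4, triple_self_left]
  by_cases e3 : l₃ • comb a b c g 0 α = k₁ • comb a b c 0 (-1) 0
  · rw [e3, triple_self_right]
  have e2 : l₂ • comb a b c g g (α + β - 1) ≠ k₁ • comb a b c 0 (-1) 0 := fun e => by
    have := (smul_comb_inj h e).1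
    have := mul_pos hl₂ hg
    linarith
  have h4 := (inner_smul_comb_pos hk₄).1 (hξ _ h₄ e4)
  have h3 := (inner_smul_comb_pos hl₃).1 (hξ _ h₃ e3)
  have h2 := (inner_smul_comb_pos hl₂).1 (hξ _ h₂ e2)
  have h0 := (inner_smul_comb_eq_zero hk₁).1 h0
  generalize ⟪cross b c, (ξ : E3)⟫ = X at *
  generalize ⟪cross c a, (ξ : E3)⟫ = Y at *
  generalize ⟪cross a b, (ξ : E3)⟫ = Z at *
  obtain rfl : Y = 0 := by linarith
  refine triple_smul_comb_nonneg a b c hk₄ hk₁ hl₃ ?_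
  have g4 := mul_pos hg h4
  have hZ : 0 < Z := by
    refine pos_of_mul_pos_right (a := α + β - 1 - g) ?_ (by linarith)
    linarith
  have : 0 < α - g := by
    refine pos_of_mul_pos_left (b := Z) ?_ hZ.le
    linarith
  linarith

theorem triple_nonneg_of_isSide_right (h : triple a b c ≠ 0)
    (hk₃ : 0 < k₃) (hk₄ : 0 < k₄) (hl₂ : 0 < l₂) (hl₁ : 0 < l₁) (hg : 0 < g)
    (hαβ : 1 + g < α + β) {ws : List E3}
    (h₄ : k₄ • comb a b c (-1) (-1) (-1) ∈ ws) (h₁ : l₁ • comb a b c 0 g β ∈ ws)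
    (h₂ : l₂ • comb a b c g g (α + β - 1) ∈ ws)
    (hside : IsSide ws (k₃ • comb a b c (-1) 0 0)) :
    0 ≤ triple (k₄ • comb a b c (-1) (-1) (-1)) (l₁ • comb a b c 0 g β)
      (k₃ • comb a b c (-1) 0 0) := by
  obtain ⟨ξ, h0, hξ⟩ := hside
  by_cases e4 : k₄ • comb a b c (-1) (-1) (-1) = k₃ • comb a b c (-1) 0 0
  · rw [e4, triple_self_outer]
  by_cases e1 : l₁ • comb a b c 0 g β = k₃ • comb a b c (-1) 0 0
  · rw [e1, triple_self_right]
  have e2 : l₂ • comb a b c g g (α + β - 1) ≠ k₃ • comb a b c (-1) 0 0 := fun e => by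
    have := (smul_comb_inj h e).2.1
    have := mul_pos hl₂ hg
    linarith
  have h4 := (inner_smul_comb_pos hk₄).1 (hξ _ h₄ e4)
  have h1 := (inner_smul_comb_pos hl₁).1 (hξ _ h₁ e1)
  have h2 := (inner_smul_comb_pos hl₂).1 (hξ _ h₂ e2)
  have h0 := (inner_smul_comb_eq_zero hk₃).1 h0
  generalize ⟪cross b c, (ξ : E3)⟫ = X at *
  generalize ⟪cross c a, (ξ : E3)⟫ = Y at *
  generalize ⟪cross a b, (ξ : E3)⟫ = Z at *
  obtain rfl : X = 0 := by linarith
  refine triple_smul_comb_nonneg a b c hk₄ hl₁ hk₃ ?_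
  have g4 := mul_pos hg h4
  have hZ : 0 < Z := by
    refine pos_of_mul_pos_right (a := α + β - 1 - g) ?_ (by linarith)
    linarith
  have : 0 < β - g := by
    refine pos_of_mul_pos_left (b := Z) ?_ hZ.le
    linarith
  linarith

/-- Only two triples, with determinants $\alpha - g$ and $\beta - g$, need the side condition. The
conditions $1 < \alpha$ and $1 < \beta$ enter through determinants such as $g(\beta - 1)$ when the
additional circles are listed. -/
theorem isCounterclockwise_six (h : triple a b c ≠ 0)
    (hk₁ : 0 < k₁) (hk₃ : 0 < k₃) (hk₄ : 0 < k₄) (hl₁ : 0 < l₁) (hl₂ : 0 < l₂) (hl₃ : 0 < l₃)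
    (hα : 0 < α) (hβ : 0 < β) (hg : 0 < g) (hαβ : 1 + g < α + β) :
    IsCounterclockwise [k₄ • comb a b c (-1) (-1) (-1), k₁ • comb a b c 0 (-1) 0,
        l₂ • comb a b c g g (α + β - 1), k₃ • comb a b c (-1) 0 0] ∧
      (1 < α → IsCounterclockwise [k₄ • comb a b c (-1) (-1) (-1), k₁ • comb a b c 0 (-1) 0,
        l₂ • comb a b c g g (α + β - 1), l₁ • comb a b c 0 g β, k₃ • comb a b c (-1) 0 0]) ∧
      (1 < β → IsCounterclockwise [k₄ • comb a b c (-1) (-1) (-1), k₁ • comb a b c 0 (-1) 0,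
        l₃ • comb a b c g 0 α, l₂ • comb a b c g g (α + β - 1), k₃ • comb a b c (-1) 0 0]) ∧
      (1 < α → 1 < β → IsCounterclockwise [k₄ • comb a b c (-1) (-1) (-1),
        k₁ • comb a b c 0 (-1) 0, l₃ • comb a b c g 0 α, l₂ • comb a b c g g (α + β - 1),
        l₁ • comb a b c 0 g β, k₃ • comb a b c (-1) 0 0]) := by
  have hgα := mul_pos hg hα
  have hgβ := mul_pos hg hβ
  have hgg := mul_pos hg hg
  have hggg := mul_pos hgg hg
  have hS : 0 < g * (α + β - 1 - g) := mul_pos hg (by linarith)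
  have hS' : 0 < α + β - 1 := by linarith
  have side₁ := fun ws => triple_nonneg_of_isSide_left (ws := ws) h hk₁ hk₄ hl₂ hl₃ hg hαβ
  have side₃ := fun ws => triple_nonneg_of_isSide_right (ws := ws) h hk₃ hk₄ hl₂ hl₁ hg hαβ
  refine ⟨?_, fun hα1 => ?_, fun hβ1 => ?_, fun hα1 hβ1 => ?_⟩
  on_goal 2 => have hgα1 := mul_pos hg (sub_pos.2 hα1)
  on_goal 3 => have hgβ1 := mul_pos hg (sub_pos.2 hβ1)
  on_goal 4 =>
    have hgα1 := mul_pos hg (sub_pos.2 hα1)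
    have hgβ1 := mul_pos hg (sub_pos.2 hβ1)
  all_goals
    simp only [IsCounterclockwise, List.triplewise_cons, List.pairwise_cons, List.mem_cons,
      List.not_mem_nil, or_false, forall_eq_or_imp, forall_eq, List.Pairwise.nil,
      List.Triplewise.nil, IsEmpty.forall_iff, implies_true, and_true]
    repeat' apply And.intro
    all_goals first
      | exact fun _ _ _ => triple_smul_comb_nonneg a b c (by assumption) (by assumption)
          (by assumption) (by linarith)
      | exact fun _ hs _ => side₁ _ (by simp) (by simp) (by simp) hs
      | exact fun _ _ hs => side₃ _ (by simp) (by simp) (by simp) hs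

end

/-! ### Inequalities for the joint region, its openness and the probability. -/

theorem antipode_antipode (S : Set S2) : antipode (antipode S) = S := by
  ext ξ
  simp [antipode]

theorem isOpen_hemispheres (ws : List E3) : IsOpen (hemispheres ws) := by
  have : hemispheres ws = ⋂ w ∈ ws.toFinset, {ξ : S2 | 0 < ⟪w, (ξ : E3)⟫} := by
    ext ξ
    simp [hemispheres]
  rw [this]
  exact isOpen_biInter_finset fun w _ =>
    isOpen_lt continuous_const (continuous_const.inner continuous_subtype_val)

section

variable {p : ℕ → E3} {i j : ℕ}

namespace Frame

variable (F : Frame p i j)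

theorem crossingSign_of_pos (h : 0 < triple F.a F.b F.c) : crossingSign p i j = -1 := by
  rw [F.crossingSign_eq, Real.sign_of_neg (by linarith)]

theorem crossingSign_of_neg (h : triple F.a F.b F.c < 0) : crossingSign p i j = 1 := by
  rw [F.crossingSign_eq, Real.sign_of_pos (by linarith)]

theorem neg_of_crossingSign_eq (h : crossingSign p i j = crossingSign p i (j + 1)) : F.γ < 0 := by
  by_contra! hγ
  have hγ := lt_of_le_of_ne hγ F.hγ.symm
  rw [F.crossingSign_eq, F.crossingSign_succ_eq] at h
  rcases lt_or_gt_of_ne F.vol with h0 | h0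
  · rw [Real.sign_of_pos (by linarith), Real.sign_of_neg (mul_neg_of_pos_of_neg hγ h0)] at h
    linarith
  · rw [Real.sign_of_neg (by linarith), Real.sign_of_pos (mul_pos hγ h0)] at h
    linarith

theorem pos_of_crossingSign_eq (h : crossingSign p i j = -crossingSign p i (j + 1)) : 0 < F.γ := by
  by_contra! hγ
  have hγ := lt_of_le_of_ne hγ F.hγ
  rw [F.crossingSign_eq, F.crossingSign_succ_eq] at h
  rcases lt_or_gt_of_ne F.vol with h0 | h0
  · rw [Real.sign_of_pos (by linarith), Real.sign_of_pos (mul_pos_of_neg_of_neg hγ h0)] at h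
    linarith
  · rw [Real.sign_of_neg (by linarith), Real.sign_of_neg (mul_neg_of_neg_of_pos hγ h0)] at h
    linarith

theorem triple_mul_crossingSign : triple F.a F.b F.c * crossingSign p i j < 0 := by
  rcases lt_or_gt_of_ne F.vol with h0 | h0
  · rw [F.crossingSign_of_neg h0]; linarith
  · rw [F.crossingSign_of_pos h0]; linarith

theorem inner_coord {x y z : ℝ} {v : E3} (hv : v = x • F.a + y • F.b + z • F.c) :
    ⟪cross F.b F.c, v⟫ = triple F.a F.b F.c * x ∧ ⟪cross F.c F.a, v⟫ = triple F.a F.b F.c * y ∧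
      ⟪cross F.a F.b, v⟫ = triple F.a F.b F.c * z := by
  have key (x' y' z' : ℝ) := inner_comb_frame F.a F.b F.c x' y' z' x y z
  rw [← hv] at key
  exact ⟨by simpa [comb] using key 1 0 0, by simpa [comb] using key 0 1 0,
    by simpa [comb] using key 0 0 1⟩

/-- The two regions force $z < 0$ and $z/\gamma < 0$, so the sign of $\gamma$ decides which of the
two pieces of `Q₃` can be non-empty: here the direct one, for $\gamma < 0$ the antipodal one. -/
theorem mem_Q₃_of_pos (hγ : 0 < F.γ) {ξ : S2} {x y z : ℝ}
    (hξ : (ξ : E3) = x • F.a + y • F.b + z • F.c) :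
    ξ ∈ Q₃ p i j (j + 1) ↔ 0 < x ∧ 0 < y ∧ z < 0 ∧ 0 < x + y + z ∧ 0 < F.γ * x - F.α * z ∧
      0 < F.γ * y - F.β * z ∧ 0 < F.γ * x + F.γ * y + (1 - F.α - F.β) * z := by
  have hξ' : ((-ξ : S2) : E3) = (-x) • F.a + (-y) • F.b + (-z) • F.c := by
    change -(ξ : E3) = _
    rw [hξ]; module
  have e1 : F.γ * x - F.α * z = F.γ * (x - z / F.γ * F.α) := by field_simp
  have e2 : F.γ * y - F.β * z = F.γ * (y - z / F.γ * F.β) := by field_simp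
  have e3 : F.γ * x + F.γ * y + (1 - F.α - F.β) * z =
    F.γ * (x - z / F.γ * F.α + (y - z / F.γ * F.β) + z / F.γ) := by field_simp; ring
  have e4 : z / F.γ < 0 ↔ z < 0 := by rw [div_lt_iff₀ hγ, zero_mul]
  rw [e1, e2, e3, mul_pos_iff_of_pos_left hγ, mul_pos_iff_of_pos_left hγ,
    mul_pos_iff_of_pos_left hγ, Q₃, Set.mem_union, Set.mem_inter_iff, Set.mem_inter_iff,
    F.mem_Q hξ, F.mem_Q_succ hξ, e4]
  change _ ∨ (-ξ ∈ Q p i j ∧ _) ↔ _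
  rw [F.mem_Q hξ']
  constructor
  · rintro (h | h)
    · tauto
    · linarith [h.1.2.2.1, h.2.2.2.1]
  · tauto

theorem mem_Q₃_of_neg (hγ : F.γ < 0) {ξ : S2} {x y z : ℝ}
    (hξ : (ξ : E3) = x • F.a + y • F.b + z • F.c) :
    ξ ∈ Q₃ p i j (j + 1) ↔ x < 0 ∧ y < 0 ∧ 0 < z ∧ x + y + z < 0 ∧ F.γ * x - F.α * z < 0 ∧
      F.γ * y - F.β * z < 0 ∧ F.γ * x + F.γ * y + (1 - F.α - F.β) * z < 0 := by
  have hξ' : ((-ξ : S2) : E3) = (-x) • F.a + (-y) • F.b + (-z) • F.c := by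
    change -(ξ : E3) = _
    rw [hξ]; module
  have hγ' := hγ.ne
  have e1 : F.γ * x - F.α * z = F.γ * (x - z / F.γ * F.α) := by field_simp
  have e2 : F.γ * y - F.β * z = F.γ * (y - z / F.γ * F.β) := by field_simp
  have e3 : F.γ * x + F.γ * y + (1 - F.α - F.β) * z =
    F.γ * (x - z / F.γ * F.α + (y - z / F.γ * F.β) + z / F.γ) := by field_simp; ring
  have e4 : z / F.γ < 0 ↔ 0 < z := by rw [div_lt_iff_of_neg hγ, zero_mul]
  have e5 (r : ℝ) : F.γ * r < 0 ↔ 0 < r := by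
    rw [← neg_pos, ← neg_mul, mul_pos_iff_of_pos_left (neg_pos.2 hγ)]
  rw [e1, e2, e3, e5, e5, e5, Q₃, Set.mem_union, Set.mem_inter_iff, Set.mem_inter_iff,
    F.mem_Q hξ, F.mem_Q_succ hξ, e4]
  change _ ∨ (-ξ ∈ Q p i j ∧ _) ↔ _
  rw [F.mem_Q hξ', neg_pos, neg_pos, neg_lt_zero,
    show 0 < -x + -y + -z ↔ x + y + z < 0 by constructor <;> intro <;> linarith]
  constructor
  · rintro (h | h)
    · linarith [h.1.2.2.1, h.2.2.2.1]
    · tauto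
  · tauto

/-- Pairing with the dual basis multiplies coordinates by `triple F.a F.b F.c`, whose sign is
opposite to $\epsilon_{i,j}$. The antipode in `Q₃signed` cancels that sign, so the inequalities in
the pairings are the same for both orientations. -/
theorem mem_Q₃signed {ξ : S2} {x y z : ℝ} (hξ : (ξ : E3) = x • F.a + y • F.b + z • F.c) :
    ∃ ξ' : S2, ∃ s : ℝ, 0 < s ∧ (ξ ∈ Q₃signed p i j (j + 1) ↔ ξ' ∈ Q₃ p i j (j + 1)) ∧
      (ξ' : E3) = (s * ⟪cross F.b F.c, (ξ : E3)⟫) • F.a + (s * ⟪cross F.c F.a, (ξ : E3)⟫) • F.b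
        + (s * ⟪cross F.a F.b, (ξ : E3)⟫) • F.c := by
  obtain ⟨h1, h2, h3⟩ := F.inner_coord hξ
  rw [h1, h2, h3]
  rcases lt_or_gt_of_ne F.vol with h0 | h0
  · refine ⟨-ξ, -(triple F.a F.b F.c)⁻¹, by simpa using h0, ?_, ?_⟩
    · rw [Q₃signed, F.crossingSign_of_neg h0, if_neg (by norm_num)]
      rfl
    · change -(ξ : E3) = _
      rw [hξ]
      simp only [neg_mul, inv_mul_cancel_left₀ F.vol]
      module
  · refine ⟨ξ, (triple F.a F.b F.c)⁻¹, by simpa using h0, ?_, ?_⟩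
    · rw [Q₃signed, F.crossingSign_of_pos h0, if_pos rfl]
    · simp only [inv_mul_cancel_left₀ F.vol]
      exact hξ

theorem mem_Q₃signed_of_pos (hγ : 0 < F.γ) {ξ : S2} {X Y Z : ℝ}
    (hX : ⟪cross F.b F.c, (ξ : E3)⟫ = X) (hY : ⟪cross F.c F.a, (ξ : E3)⟫ = Y)
    (hZ : ⟪cross F.a F.b, (ξ : E3)⟫ = Z) :
    ξ ∈ Q₃signed p i j (j + 1) ↔ 0 < X ∧ 0 < Y ∧ Z < 0 ∧ 0 < X + Y + Z ∧
      0 < F.γ * X - F.α * Z ∧ 0 < F.γ * Y - F.β * Z ∧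
      0 < F.γ * X + F.γ * Y + (1 - F.α - F.β) * Z := by
  obtain ⟨x, y, z, hξ⟩ := exists_frame_coord F.vol ξ
  obtain ⟨ξ', s, hs, h, hξ'⟩ := F.mem_Q₃signed hξ
  rw [h, F.mem_Q₃_of_pos hγ hξ', hX, hY, hZ, ← mul_pos_iff_of_pos_left hs (b := X),
    ← mul_pos_iff_of_pos_left hs (b := Y), ← mul_pos_iff_of_pos_left hs (b := X + Y + Z),
    ← mul_pos_iff_of_pos_left hs (b := F.γ * X - F.α * Z),
    ← mul_pos_iff_of_pos_left hs (b := F.γ * Y - F.β * Z),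
    ← mul_pos_iff_of_pos_left hs (b := F.γ * X + F.γ * Y + (1 - F.α - F.β) * Z),
    ← neg_pos (a := Z), ← mul_pos_iff_of_pos_left hs (b := -Z), ← neg_pos (a := s * Z)]
  ring_nf

theorem mem_Q₃signed_of_neg (hγ : F.γ < 0) {ξ : S2} {X Y Z : ℝ}
    (hX : ⟪cross F.b F.c, (ξ : E3)⟫ = X) (hY : ⟪cross F.c F.a, (ξ : E3)⟫ = Y)
    (hZ : ⟪cross F.a F.b, (ξ : E3)⟫ = Z) :
    ξ ∈ Q₃signed p i j (j + 1) ↔ X < 0 ∧ Y < 0 ∧ 0 < Z ∧ X + Y + Z < 0 ∧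
      F.γ * X - F.α * Z < 0 ∧ F.γ * Y - F.β * Z < 0 ∧
      F.γ * X + F.γ * Y + (1 - F.α - F.β) * Z < 0 := by
  obtain ⟨x, y, z, hξ⟩ := exists_frame_coord F.vol ξ
  obtain ⟨ξ', s, hs, h, hξ'⟩ := F.mem_Q₃signed hξ
  have e (r : ℝ) := mul_neg_iff_of_pos_left (r := r) hs
  rw [h, F.mem_Q₃_of_neg hγ hξ', hX, hY, hZ, ← mul_pos_iff_of_pos_left hs (b := Z),
    ← e X, ← e Y, ← e (X + Y + Z), ← e (F.γ * X - F.α * Z), ← e (F.γ * Y - F.β * Z),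
    ← e (F.γ * X + F.γ * Y + (1 - F.α - F.β) * Z)]
  ring_nf

theorem isOpen_Q₃signed (F : Frame p i j) : IsOpen (Q₃signed p i j (j + 1)) := by
  rcases lt_or_gt_of_ne F.hγ with hγ | hγ
  · convert isOpen_hemispheres [comb F.a F.b F.c (-1) 0 0, comb F.a F.b F.c 0 (-1) 0,
      comb F.a F.b F.c 0 0 1, comb F.a F.b F.c (-1) (-1) (-1), comb F.a F.b F.c (-F.γ) 0 F.α,
      comb F.a F.b F.c 0 (-F.γ) F.β, comb F.a F.b F.c (-F.γ) (-F.γ) (-(1 - F.α - F.β))]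
    ext ξ
    rw [F.mem_Q₃signed_of_neg hγ rfl rfl rfl]
    simp only [hemispheres, Set.mem_ofPred_eq, List.mem_cons, List.not_mem_nil, or_false,
      forall_eq_or_imp, forall_eq, inner_comb]
    refine and_congr ?_ (and_congr ?_ (and_congr ?_ (and_congr ?_ (and_congr ?_
      (and_congr ?_ ?_))))) <;> constructor <;> intro <;> linarith
  · convert isOpen_hemispheres [comb F.a F.b F.c 1 0 0, comb F.a F.b F.c 0 1 0,
      comb F.a F.b F.c 0 0 (-1), comb F.a F.b F.c 1 1 1, comb F.a F.b F.c F.γ 0 (-F.α),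
      comb F.a F.b F.c 0 F.γ (-F.β), comb F.a F.b F.c F.γ F.γ (1 - F.α - F.β)]
    ext ξ
    rw [F.mem_Q₃signed_of_pos hγ rfl rfl rfl]
    simp only [hemispheres, Set.mem_ofPred_eq, List.mem_cons, List.not_mem_nil, or_false,
      forall_eq_or_imp, forall_eq, inner_comb]
    refine and_congr ?_ (and_congr ?_ (and_congr ?_ (and_congr ?_ (and_congr ?_
      (and_congr ?_ ?_))))) <;> constructor <;> intro <;> linarith

theorem isOpen_Q₃ (F : Frame p i j) : IsOpen (Q₃ p i j (j + 1)) := by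
  have h := F.isOpen_Q₃signed
  rw [Q₃signed] at h
  split_ifs at h
  · exact h
  · rw [← antipode_antipode (Q₃ p i j (j + 1))]
    exact h.preimage continuous_neg

theorem area_Q₃signed (F : Frame p i j) : area (Q₃signed p i j (j + 1)) = area (Q₃ p i j (j + 1)) := by
  rw [Q₃signed]
  split_ifs
  · rfl
  · exact area_antipode F.isOpen_Q₃.measurableSet

theorem disjoint_Q_succ_antipode (F : Frame p i j) : Disjoint (Q p i (j + 1)) (antipode (Q p i (j + 1))) := by
  rw [Set.disjoint_left]
  intro ξ h h'
  obtain ⟨x, y, z, hξ⟩ := exists_frame_coord F.vol ξ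
  have hξ' : ((-ξ : S2) : E3) = (-x) • F.a + (-y) • F.b + (-z) • F.c := by
    change -(ξ : E3) = _
    rw [hξ]; module
  have h1 := ((F.mem_Q_succ hξ).1 h).2.2.1
  have h2 := ((F.mem_Q_succ hξ').1 h').2.2.1
  rw [neg_div] at h2
  linarith

theorem directionProbability_projectionsCross (F : Frame p i j) (h : crossingSign p i j ≠ 0)
    (h' : crossingSign p i (j + 1) ≠ 0) :
    directionProbability {ξ | ProjectionsCross p i j ξ ∧ ProjectionsCross p i (j + 1) ξ} =
      1 / (2 * Real.pi) * area (Q₃ p i j (j + 1)) := by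
  have hset : {ξ | ProjectionsCross p i j ξ ∧ ProjectionsCross p i (j + 1) ξ} =
      Q₃ p i j (j + 1) ∪ antipode (Q₃ p i j (j + 1)) := by
    ext ξ
    simp only [Set.mem_ofPred_eq, projectionsCross_iff (disjoint_edge h),
      projectionsCross_iff (disjoint_edge h'), Q₃, antipode, Set.mem_union, Set.mem_inter_iff,
      neg_neg]
    tauto
  have hsub : Q₃ p i j (j + 1) ⊆ Q p i (j + 1) :=
    Set.union_subset Set.inter_subset_right Set.inter_subset_right
  have hd : Disjoint (Q₃ p i j (j + 1)) (antipode (Q₃ p i j (j + 1))) :=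
    F.disjoint_Q_succ_antipode.mono hsub fun ξ hξ => hsub (a := -ξ) hξ
  rw [directionProbability, hset, area_union_antipode F.isOpen_Q₃.measurableSet hd, area_univ]
  field_simp
  ring

end Frame
end

/-! ### Non-emptiness, emptiness and the polygons. -/

section

variable {p : ℕ → E3} {i j : ℕ}

namespace Frame

variable (F : Frame p i j)

theorem Q₃signed_nonempty_of_pos (hγ : 0 < F.γ) : (Q₃signed p i j (j + 1)).Nonempty := by
  -- For $(N, N, -1)$ all the inequalities hold once $N > 1$ and $\gamma N$ exceeds $1 + |\alpha| +
  -- |\beta|$.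
  set N := 1 + (1 + |F.α| + |F.β|) / F.γ with hN
  have hN' : F.γ * N = F.γ + (1 + |F.α| + |F.β|) := by rw [hN]; field_simp
  have hN1 : 1 < N := by
    have : 0 < (1 + |F.α| + |F.β|) / F.γ := by positivity
    linarith
  obtain ⟨ξ, k, hk, hX, hY, hZ⟩ := exists_coord_eq F.vol (X := N) (Y := N) (Z := -1) (by norm_num)
  refine ⟨ξ, (F.mem_Q₃signed_of_pos hγ hX hY hZ).2 ?_⟩
  have a1 := neg_abs_le F.α
  have a2 := neg_abs_le F.β
  have a3 := abs_nonneg F.α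
  have a4 := abs_nonneg F.β
  refine ⟨by nlinarith, by nlinarith, by nlinarith, by nlinarith, ?_, ?_, ?_⟩
  · rw [show F.γ * (k * N) - F.α * (k * -1) = k * (F.γ * N + F.α) by ring]
    exact mul_pos hk (by linarith)
  · rw [show F.γ * (k * N) - F.β * (k * -1) = k * (F.γ * N + F.β) by ring]
    exact mul_pos hk (by linarith)
  · rw [show F.γ * (k * N) + F.γ * (k * N) + (1 - F.α - F.β) * (k * -1) =
      k * (F.γ * N + F.γ * N - 1 + F.α + F.β) by ring]
    exact mul_pos hk (by linarith)

theorem Q₃signed_nonempty_of_neg (hγ : F.γ < 0) (hα : 0 < F.α) (hβ : 0 < F.β)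
    (hαβ : 1 - F.γ < F.α + F.β) : (Q₃signed p i j (j + 1)).Nonempty := by
  set T := F.α + F.β with hT
  have hg : 0 < -F.γ := by linarith
  have hr : 0 < -F.γ + T - 1 := by linarith
  -- On the ray $(-\alpha s, -\beta s, Z)$ the conditions reduce to $1/T < s/Z < (T - 1)/(gT)$ with
  -- $g = -\gamma$; the witness is the midpoint, cleared of denominators.
  obtain ⟨ξ, k, hk, hX, hY, hZ⟩ := exists_coord_eq F.vol (X := -F.α * (-F.γ + T - 1))
    (Y := -F.β * (-F.γ + T - 1)) (Z := 2 * -F.γ * T) (by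
      have : 0 < T := by linarith
      positivity)
  refine ⟨ξ, (F.mem_Q₃signed_of_neg hγ hX hY hZ).2 ?_⟩
  have hT0 : 0 < T := by linarith
  have e (r : ℝ) := mul_neg_iff_of_pos_left (r := r) hk
  refine ⟨?_, ?_, by positivity, ?_, ?_, ?_, ?_⟩
  · rw [e, neg_mul, neg_lt_zero]; positivity
  · rw [e, neg_mul, neg_lt_zero]; positivity
  · rw [← mul_add, ← mul_add, e]
    have := mul_pos hT0 (show 0 < T - 1 + F.γ by linarith)
    linear_combination this + (-F.γ + T - 1) * hT
  · rw [show F.γ * (k * (-F.α * (-F.γ + T - 1))) - F.α * (k * (2 * -F.γ * T)) =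
      k * -(F.α * -F.γ * (T + 1 + F.γ)) by ring, e, neg_lt_zero]
    exact mul_pos (mul_pos hα hg) (by linarith)
  · rw [show F.γ * (k * (-F.β * (-F.γ + T - 1))) - F.β * (k * (2 * -F.γ * T)) =
      k * -(F.β * -F.γ * (T + 1 + F.γ)) by ring, e, neg_lt_zero]
    exact mul_pos (mul_pos hβ hg) (by linarith)
  · rw [show F.γ * (k * (-F.α * (-F.γ + T - 1))) + F.γ * (k * (-F.β * (-F.γ + T - 1))) +
        (1 - F.α - F.β) * (k * (2 * -F.γ * T)) = k * -(-F.γ * T * (T - 1 + F.γ)) by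
      rw [hT]; ring, e, neg_lt_zero]
    exact mul_pos (mul_pos hg hT0) (by linarith)

/-- Since $\gamma x, \gamma y > 0$ and $z > 0$, membership forces $\alpha, \beta > 0$; comparing the
two inequalities involving $x + y$ forces $\alpha + \beta > 1 - \gamma$. -/
theorem Q₃_eq_empty (hγ : F.γ < 0) (h : F.α + F.β < 1 - F.γ ∨ F.α * F.β < 0) :
    Q₃ p i j (j + 1) = ∅ := by
  rw [Set.eq_empty_iff_forall_notMem]
  intro ξ hξ
  obtain ⟨x, y, z, hxyz⟩ := exists_frame_coord F.vol ξ
  obtain ⟨h1, h2, h3, h4, h5, h6, h7⟩ := (F.mem_Q₃_of_neg hγ hxyz).1 hξ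
  have g1 := mul_pos_of_neg_of_neg hγ h1
  have g2 := mul_pos_of_neg_of_neg hγ h2
  have g4 := mul_pos_of_neg_of_neg hγ h4
  have hα : 0 < F.α := pos_of_mul_pos_left (b := z) (by linarith) h3.le
  have hβ : 0 < F.β := pos_of_mul_pos_left (b := z) (by linarith) h3.le
  rcases h with h | h
  · nlinarith
  · nlinarith

/-- For $Z < 0$ the other six inequalities come in three pairs, and in each pair one implies the
other. The parameters encode the surviving ones, so that all eight cases are handled at once; the
listed normals point outward. -/
theorem isSphericalPolygon_of_pos (hγ : 0 < F.γ) {v₁ v₂ v₃ v₄ : E3}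
    {k₁ k₂ k₃ k₄ s t r q m l : ℝ} (hk₁ : 0 < k₁) (hk₂ : 0 < k₂) (hk₃ : 0 < k₃) (hk₄ : 0 < k₄)
    (hs : 0 < s) (ht : 0 < t) (hr : 0 < r)
    (h₁ : -v₁ = k₁ • comb F.a F.b F.c 0 0 (-1)) (h₂ : -v₂ = k₂ • comb F.a F.b F.c 0 s q)
    (h₃ : -v₃ = k₃ • comb F.a F.b F.c t t m) (h₄ : -v₄ = k₄ • comb F.a F.b F.c r 0 l)
    (hY : ∀ Y Z, Z < 0 → (0 < s * Y + q * Z ↔ 0 < Y ∧ 0 < F.γ * Y - F.β * Z))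
    (hXY : ∀ X Y Z, Z < 0 → (0 < t * X + t * Y + m * Z ↔
      0 < X + Y + Z ∧ 0 < F.γ * X + F.γ * Y + (1 - F.α - F.β) * Z))
    (hX : ∀ X Z, Z < 0 → (0 < r * X + l * Z ↔ 0 < X ∧ 0 < F.γ * X - F.α * Z)) :
    IsSphericalPolygon [v₁, v₂, v₃, v₄] (Q₃signed p i j (j + 1)) := by
  refine ⟨F.Q₃signed_nonempty_of_pos hγ, Or.inr ⟨?_, ?_⟩⟩
  · ext ξ
    rw [F.mem_Q₃signed_of_pos hγ rfl rfl rfl]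
    simp only [List.map_cons, List.map_nil, h₁, h₂, h₃, h₄, hemispheres, Set.mem_ofPred_eq,
      List.mem_cons, List.not_mem_nil, or_false, forall_eq_or_imp, forall_eq,
      inner_smul_comb_pos hk₁, inner_smul_comb_pos hk₂, inner_smul_comb_pos hk₃,
      inner_smul_comb_pos hk₄, zero_mul, zero_add, add_zero, neg_one_mul, neg_pos]
    have hY := hY ⟪cross F.c F.a, (ξ : E3)⟫ ⟪cross F.a F.b, (ξ : E3)⟫
    have hX := hX ⟪cross F.b F.c, (ξ : E3)⟫ ⟪cross F.a F.b, (ξ : E3)⟫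
    have hXY := hXY ⟪cross F.b F.c, (ξ : E3)⟫ ⟪cross F.c F.a, (ξ : E3)⟫ ⟪cross F.a F.b, (ξ : E3)⟫
    tauto
  · simp only [List.map_cons, List.map_nil, h₁, h₂, h₃, h₄]
    exact isCounterclockwise_four F.vol hk₁ hk₂ hk₃ hk₄ hs ht hr

/-- The bound $Z > 0$ follows from the circles of $n_1$, $n_3$, $u_2$. The form of $-u_3$ equals
that of $-u_2$ plus $(1 - \beta)Z + \gamma Y$, hence is redundant for $\beta < 1$; symmetrically
$-u_1$ is redundant for $\alpha < 1$. -/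
theorem isSphericalPolygon_of_neg (hγ : F.γ < 0) (hα : 0 < F.α) (hβ : 0 < F.β)
    (hαβ : 1 - F.γ < F.α + F.β) {n₁ n₃ n₄ u₁ u₂ u₃ : E3} {k₁ k₃ k₄ l₁ l₂ l₃ : ℝ}
    (hk₁ : 0 < k₁) (hk₃ : 0 < k₃) (hk₄ : 0 < k₄) (hl₁ : 0 < l₁) (hl₂ : 0 < l₂) (hl₃ : 0 < l₃)
    (hn₁ : n₁ = k₁ • comb F.a F.b F.c 0 (-1) 0) (hn₃ : n₃ = k₃ • comb F.a F.b F.c (-1) 0 0)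
    (hn₄ : n₄ = k₄ • comb F.a F.b F.c (-1) (-1) (-1))
    (hu₁ : u₁ = l₁ • comb F.a F.b F.c 0 F.γ (-F.β))
    (hu₂ : u₂ = l₂ • comb F.a F.b F.c F.γ F.γ (1 - F.α - F.β))
    (hu₃ : u₃ = l₃ • comb F.a F.b F.c F.γ 0 (-F.α)) :
    (F.α < 1 → F.β < 1 → IsSphericalPolygon [n₄, n₁, -u₂, n₃] (Q₃signed p i j (j + 1))) ∧
    (1 < F.α → F.β < 1 → IsSphericalPolygon [n₄, n₁, -u₂, -u₁, n₃] (Q₃signed p i j (j + 1))) ∧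
    (F.α < 1 → 1 < F.β → IsSphericalPolygon [n₄, n₁, -u₃, -u₂, n₃] (Q₃signed p i j (j + 1))) ∧
    (1 < F.α → 1 < F.β →
      IsSphericalPolygon [n₄, n₁, -u₃, -u₂, -u₁, n₃] (Q₃signed p i j (j + 1))) := by
  have hu₁' : -u₁ = l₁ • comb F.a F.b F.c 0 (-F.γ) F.β := by
    rw [hu₁, ← smul_neg, neg_comb, neg_neg, neg_zero]
  have hu₂' : -u₂ = l₂ • comb F.a F.b F.c (-F.γ) (-F.γ) (F.α + F.β - 1) := by
    rw [hu₂, ← smul_neg, neg_comb, show -(1 - F.α - F.β) = F.α + F.β - 1 by ring]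
  have hu₃' : -u₃ = l₃ • comb F.a F.b F.c (-F.γ) 0 F.α := by
    rw [hu₃, ← smul_neg, neg_comb, neg_neg, neg_zero]
  have hg : 0 < -F.γ := neg_pos.2 hγ
  obtain ⟨c₁, c₂, c₃, c₄⟩ := isCounterclockwise_six F.vol hk₁ hk₃ hk₄ hl₁ hl₂ hl₃ hα hβ hg
    (by linarith)
  have hne := F.Q₃signed_nonempty_of_neg hγ hα hβ hαβ
  have hZ {X Y Z : ℝ} (h1 : X < 0) (h3 : Y < 0)
      (h2 : 0 < -F.γ * X + -F.γ * Y + (F.α + F.β - 1) * Z) : 0 < Z := by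
    have g1 := mul_pos hg (neg_pos.2 h1)
    have g3 := mul_pos hg (neg_pos.2 h3)
    refine pos_of_mul_pos_right (a := F.α + F.β - 1) ?_ (by linarith)
    linarith
  have hL (hβ1 : F.β < 1) {X Y Z : ℝ} (h1 : X < 0) (h3 : Y < 0)
      (h2 : 0 < -F.γ * X + -F.γ * Y + (F.α + F.β - 1) * Z) : 0 < -F.γ * X + F.α * Z := by
    have g1 := mul_pos (sub_pos.2 hβ1) (hZ h1 h3 h2)
    have g3 := mul_pos hg (neg_pos.2 h3)
    linarith
  have hR (hα1 : F.α < 1) {X Y Z : ℝ} (h1 : X < 0) (h3 : Y < 0)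
      (h2 : 0 < -F.γ * X + -F.γ * Y + (F.α + F.β - 1) * Z) : 0 < -F.γ * Y + F.β * Z := by
    have g1 := mul_pos (sub_pos.2 hα1) (hZ h1 h3 h2)
    have g3 := mul_pos hg (neg_pos.2 h1)
    linarith
  have mem (ξ : S2) : ξ ∈ Q₃signed p i j (j + 1) ↔
      0 < ⟪n₃, (ξ : E3)⟫ ∧ 0 < ⟪n₁, (ξ : E3)⟫ ∧ 0 < ⟪n₄, (ξ : E3)⟫ ∧ 0 < ⟪-u₃, (ξ : E3)⟫ ∧
        0 < ⟪-u₁, (ξ : E3)⟫ ∧ 0 < ⟪-u₂, (ξ : E3)⟫ := by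
    rw [F.mem_Q₃signed_of_neg hγ rfl rfl rfl, hn₁, hn₃, hn₄, hu₁', hu₂', hu₃',
      inner_smul_comb_pos hk₁, inner_smul_comb_pos hk₃, inner_smul_comb_pos hk₄,
      inner_smul_comb_pos hl₁, inner_smul_comb_pos hl₂, inner_smul_comb_pos hl₃]
    constructor
    · rintro ⟨h1, h2, h3, h4, h5, h6, h7⟩
      refine ⟨?_, ?_, ?_, ?_, ?_, ?_⟩ <;> linarith
    · rintro ⟨h1, h2, h3, h4, h5, h6⟩
      have h0 := hZ (by linarith) (by linarith) h6
      refine ⟨?_, ?_, h0, ?_, ?_, ?_, ?_⟩ <;> linarith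
  have left (hβ1 : F.β < 1) (ξ : S2) (h3 : 0 < ⟪n₃, (ξ : E3)⟫) (h1 : 0 < ⟪n₁, (ξ : E3)⟫)
      (h2 : 0 < ⟪-u₂, (ξ : E3)⟫) : 0 < ⟪-u₃, (ξ : E3)⟫ := by
    rw [hn₃, inner_smul_comb_pos hk₃] at h3
    rw [hn₁, inner_smul_comb_pos hk₁] at h1
    rw [hu₂', inner_smul_comb_pos hl₂] at h2
    rw [hu₃', inner_smul_comb_pos hl₃]
    have := hL hβ1 (by linarith) (by linarith) h2
    linarith
  have right (hα1 : F.α < 1) (ξ : S2) (h3 : 0 < ⟪n₃, (ξ : E3)⟫) (h1 : 0 < ⟪n₁, (ξ : E3)⟫)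
      (h2 : 0 < ⟪-u₂, (ξ : E3)⟫) : 0 < ⟪-u₁, (ξ : E3)⟫ := by
    rw [hn₃, inner_smul_comb_pos hk₃] at h3
    rw [hn₁, inner_smul_comb_pos hk₁] at h1
    rw [hu₂', inner_smul_comb_pos hl₂] at h2
    rw [hu₁', inner_smul_comb_pos hl₁]
    have := hR hα1 (by linarith) (by linarith) h2
    linarith
  rw [← hn₁, ← hn₃, ← hn₄, ← hu₂'] at c₁ c₂ c₃ c₄
  rw [← hu₁'] at c₂ c₄
  rw [← hu₃'] at c₃ c₄
  refine ⟨fun hα1 hβ1 => ⟨hne, Or.inl ⟨?_, c₁⟩⟩, fun hα1 hβ1 => ⟨hne, Or.inl ⟨?_, c₂ hα1⟩⟩,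
    fun hα1 hβ1 => ⟨hne, Or.inl ⟨?_, c₃ hβ1⟩⟩, fun hα1 hβ1 => ⟨hne, Or.inl ⟨?_, c₄ hα1 hβ1⟩⟩⟩
  all_goals
    ext ξ
    rw [mem]
    simp only [hemispheres, Set.mem_ofPred_eq, List.mem_cons, List.not_mem_nil, or_false,
      forall_eq_or_imp, forall_eq]
  · exact ⟨fun ⟨h3, h1, h4, _, _, h2⟩ => ⟨h4, h1, h2, h3⟩, fun ⟨h4, h1, h2, h3⟩ =>
      ⟨h3, h1, h4, left hβ1 ξ h3 h1 h2, right hα1 ξ h3 h1 h2, h2⟩⟩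
  · exact ⟨fun ⟨h3, h1, h4, _, g1, h2⟩ => ⟨h4, h1, h2, g1, h3⟩, fun ⟨h4, h1, h2, g1, h3⟩ =>
      ⟨h3, h1, h4, left hβ1 ξ h3 h1 h2, g1, h2⟩⟩
  · exact ⟨fun ⟨h3, h1, h4, g3, _, h2⟩ => ⟨h4, h1, g3, h2, h3⟩, fun ⟨h4, h1, g3, h2, h3⟩ =>
      ⟨h3, h1, h4, g3, right hα1 ξ h3 h1 h2, h2⟩⟩
  · exact ⟨fun ⟨h3, h1, h4, g3, g1, h2⟩ => ⟨h4, h1, g3, h2, g1, h3⟩,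
      fun ⟨h4, h1, g3, h2, g1, h3⟩ => ⟨h3, h1, h4, g3, g1, h2⟩⟩

theorem inner_frame_smul_comb_mul_crossingSign (k x y z X Y Z : ℝ) :
    ⟪X • F.a + Y • F.b + Z • F.c, k • comb F.a F.b F.c x y z⟫ * crossingSign p i j =
      k * -(triple F.a F.b F.c * crossingSign p i j) * -(x * X + y * Y + z * Z) := by
  rw [real_inner_smul_right, real_inner_comm, inner_comb_frame]
  ring

/-- All three faces contain $e_i$, so both vector products are multiples of $b - a$ and the scalar
product is the product of the two factors times $\|b - a\|^2$. -/
theorem exists_inner_cross_normal : ∃ K : ℝ, 0 < K ∧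
    ⟪cross (normal₂ p i (j + 1)) (-normal₂ p i j), cross (normal₂ p i (j + 1)) (normal₄ p i j)⟫ =
      K * (F.γ * (F.α + F.β - (1 - F.γ))) := by
  obtain ⟨k, hk, h⟩ := F.normal₂_succ_eq
  obtain ⟨k₂, hk₂, h₂⟩ := F.normal₂_eq
  obtain ⟨k₄, hk₄, h₄⟩ := F.normal₄_eq
  have hab : F.b - F.a ≠ 0 := fun h0 => F.vol (by
    rw [sub_eq_zero.1 h0, triple_self_left])
  refine ⟨k ^ 2 * k₂ * k₄ * triple F.a F.b F.c ^ 2 * ‖F.b - F.a‖ ^ 2, ?_, ?_⟩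
  · have := F.vol
    have := norm_pos_iff.2 hab
    positivity
  · have hs (s t : ℝ) (u v : E3) : cross (s • u) (t • v) = (s * t) • cross u v := by
      apply E3.ext <;>
      · simp [cross_apply_zero, cross_apply_one, cross_apply_two]
        ring
    rw [h, h₂, h₄, ← smul_neg, neg_comb, hs, hs, cross_comb, cross_comb, real_inner_smul_left,
      real_inner_smul_right, ← real_inner_self_eq_norm_sq]
    simp only [inner_add_left, inner_add_right, inner_sub_left, inner_sub_right,
      real_inner_smul_left, real_inner_smul_right]
    ring

/-- Likewise, the three planes all contain $e_j$, and both vector products are multiples of $c$. -/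
theorem exists_inner_cross_vec : ∃ K : ℝ, 0 < K ∧
    ⟪cross (cross (vec p j (j + 2)) (vec p (j + 1) (j + 2))) (-normal₁ p i j),
      cross (cross (vec p j (j + 2)) (vec p (j + 1) (j + 2))) (normal₃ p i j)⟫ =
      K * -(F.α * F.β) := by
  obtain ⟨k₁, hk₁, h₁⟩ := F.normal₁_eq
  obtain ⟨k₃, hk₃, h₃⟩ := F.normal₃_eq
  have hc : F.c ≠ 0 := fun h0 => F.vol (by rw [h0, triple, inner_zero_right])
  have hv : cross (vec p j (j + 2)) (vec p (j + 1) (j + 2)) =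
      comb F.a F.b F.c F.β (-F.α) 0 := by
    rw [vec, vec, F.hc, F.he]
    apply E3.ext <;>
    · simp [comb, cross_apply_zero, cross_apply_one, cross_apply_two]
      ring
  refine ⟨k₁ * k₃ * triple F.a F.b F.c ^ 2 * ‖F.c‖ ^ 2, ?_, ?_⟩
  · have := F.vol
    have := norm_pos_iff.2 hc
    positivity
  · have hs (t : ℝ) (u v : E3) : cross u (t • v) = t • cross u v := by
      apply E3.ext <;>
      · simp [cross_apply_zero, cross_apply_one, cross_apply_two]
        ring
    rw [hv, h₁, h₃, ← smul_neg, neg_comb, hs, hs, cross_comb, cross_comb, real_inner_smul_left,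
      real_inner_smul_right, ← real_inner_self_eq_norm_sq]
    simp only [inner_add_left, inner_add_right, real_inner_smul_left, real_inner_smul_right]
    ring

end Frame
end

end PolygonalChain

end

/-! ### Translation of the signs and assembly of the cases. -/

open PolygonalChain in
theorem mainTheorem7 (p : ℕ → E3) (i j : ℕ)
    (hij : crossingSign p i j ≠ 0) (hij' : crossingSign p i (j + 1) ≠ 0) :
    let ε := crossingSign p i j
    let ε' := crossingSign p i (j + 1)
    let n₁ := normal₁ p i j
    let n₂ := normal₂ p i j
    let n₃ := normal₃ p i j
    let n₄ := normal₄ p i j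
    let u₁ := normal₁ p i (j + 1)
    let u₂ := normal₂ p i (j + 1)
    let u₃ := normal₃ p i (j + 1)
    let v₃ := cross (vec p j (j + 2)) (vec p (j + 1) (j + 2))
    let w := ⟪cross u₂ (-n₂), cross u₂ n₄⟫
    let w₀ := ⟪cross v₃ (-n₁), cross v₃ n₃⟫
    let a₁ := ⟪vec p (j + 1) (i + 1), n₁⟫ * ε
    let a₂ := ⟪vec p (j + 2) (i + 1), n₁⟫ * ε
    let b₁ := ⟪vec p (j + 1) i, n₃⟫ * ε
    let b₂ := ⟪vec p (j + 2) i, n₃⟫ * ε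
    let d₀ := ⟪vec p (j + 2) i, n₁⟫ * ε
    let d₁ := ⟪vec p (j + 2) (i + 1), n₃⟫ * ε
    let P := Q₃signed p i j (j + 1)
    directionProbability {ξ | ProjectionsCross p i j ξ ∧ ProjectionsCross p i (j + 1) ξ}
        = 1 / (2 * Real.pi) * area (Q₃ p i j (j + 1)) ∧
      area P = area (Q₃ p i j (j + 1)) ∧
      (ε = ε' → w < 0 → w₀ < 0 →
          (0 < a₁ → 0 < a₂ → 0 < b₁ → 0 < b₂ →
            IsSphericalPolygon [n₄, n₁, -u₂, n₃] P) ∧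
          (0 < a₁ → 0 < a₂ → b₁ < 0 → b₂ < 0 →
            IsSphericalPolygon [n₄, n₁, -u₂, -u₁] P) ∧
          (0 < a₁ → 0 < a₂ → 0 < b₁ → b₂ < 0 →
            IsSphericalPolygon [n₄, n₁, -u₂, -u₁, n₃] P) ∧
          (0 < a₁ → 0 < a₂ → b₁ < 0 → 0 < b₂ →
            IsSphericalPolygon [n₄, n₁, -u₂, n₃, -u₁] P) ∧
          (a₁ < 0 → a₂ < 0 → 0 < b₁ → 0 < b₂ →
            IsSphericalPolygon [n₄, -u₃, -u₂, n₃] P) ∧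
          (a₁ < 0 → a₂ < 0 → b₁ < 0 → b₂ < 0 →
            IsSphericalPolygon [n₄, -u₃, -u₂, -u₁] P) ∧
          (a₁ < 0 → a₂ < 0 → 0 < b₁ → b₂ < 0 →
            IsSphericalPolygon [n₄, -u₃, -u₂, -u₁, n₃] P) ∧
          (a₁ < 0 → a₂ < 0 → b₁ < 0 → 0 < b₂ →
            IsSphericalPolygon [n₄, -u₃, -u₂, n₃, -u₁] P) ∧
          (0 < a₁ → a₂ < 0 → 0 < b₁ → 0 < b₂ →
            IsSphericalPolygon [n₄, n₁, -u₃, -u₂, n₃] P) ∧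
          (0 < a₁ → a₂ < 0 → b₁ < 0 → b₂ < 0 →
            IsSphericalPolygon [n₄, n₁, -u₃, -u₂, -u₁] P) ∧
          (0 < a₁ → a₂ < 0 → 0 < b₁ → b₂ < 0 →
            IsSphericalPolygon [n₄, n₁, -u₃, -u₂, -u₁, n₃] P) ∧
          (0 < a₁ → a₂ < 0 → b₁ < 0 → 0 < b₂ →
            IsSphericalPolygon [n₄, n₁, -u₃, -u₂, n₃, -u₁] P) ∧
          (a₁ < 0 → 0 < a₂ → 0 < b₁ → 0 < b₂ →
            IsSphericalPolygon [n₄, -u₃, n₁, -u₂, n₃] P) ∧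
          (a₁ < 0 → 0 < a₂ → b₁ < 0 → b₂ < 0 →
            IsSphericalPolygon [n₄, -u₃, n₁, -u₂, -u₁] P) ∧
          (a₁ < 0 → 0 < a₂ → 0 < b₁ → b₂ < 0 →
            IsSphericalPolygon [n₄, -u₃, n₁, -u₂, -u₁, n₃] P) ∧
          (a₁ < 0 → 0 < a₂ → b₁ < 0 → 0 < b₂ →
            IsSphericalPolygon [n₄, -u₃, n₁, -u₂, n₃, -u₁] P)) ∧
      (ε = ε' → (0 < w ∨ 0 < w₀) → Q₃ p i j (j + 1) = ∅) ∧
      (ε = -ε' → w < 0 →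
          (0 < d₀ → 0 < d₁ → IsSphericalPolygon [n₂, -u₁, -u₂, -u₃] P) ∧
          (d₀ < 0 → d₁ < 0 → IsSphericalPolygon [n₂, n₁, -u₂, n₃] P) ∧
          (d₀ < 0 → 0 < d₁ → IsSphericalPolygon [n₂, n₁, -u₂, -u₃] P) ∧
          (0 < d₀ → d₁ < 0 → IsSphericalPolygon [n₂, -u₁, -u₂, n₃] P)) ∧
      (ε = -ε' → 0 < w →
          (0 < d₀ → 0 < d₁ → IsSphericalPolygon [n₂, -u₁, n₄, -u₃] P) ∧
          (d₀ < 0 → d₁ < 0 → IsSphericalPolygon [n₂, n₁, n₄, n₃] P) ∧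
          (d₀ < 0 → 0 < d₁ → IsSphericalPolygon [n₂, n₁, n₄, -u₃] P) ∧
          (0 < d₀ → d₁ < 0 → IsSphericalPolygon [n₂, -u₁, n₄, n₃] P)) := by
  intro ε ε' n₁ n₂ n₃ n₄ u₁ u₂ u₃ v₃ w w₀ a₁ a₂ b₁ b₂ d₀ d₁ P
  obtain ⟨F⟩ := exists_frame hij hij'
  obtain ⟨k₁, hk₁, hn₁⟩ : ∃ k : ℝ, 0 < k ∧ n₁ = _ := F.normal₁_eq
  obtain ⟨k₂, hk₂, hn₂⟩ : ∃ k : ℝ, 0 < k ∧ n₂ = _ := F.normal₂_eq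
  obtain ⟨k₃, hk₃, hn₃⟩ : ∃ k : ℝ, 0 < k ∧ n₃ = _ := F.normal₃_eq
  obtain ⟨k₄, hk₄, hn₄⟩ : ∃ k : ℝ, 0 < k ∧ n₄ = _ := F.normal₄_eq
  obtain ⟨l₁, hl₁, hu₁⟩ : ∃ k : ℝ, 0 < k ∧ u₁ = _ := F.normal₁_succ_eq
  obtain ⟨l₂, hl₂, hu₂⟩ : ∃ k : ℝ, 0 < k ∧ u₂ = _ := F.normal₂_succ_eq
  obtain ⟨l₃, hl₃, hu₃⟩ : ∃ k : ℝ, 0 < k ∧ u₃ = _ := F.normal₃_succ_eq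
  obtain ⟨K, hK, hw⟩ : ∃ K : ℝ, 0 < K ∧ w = _ := F.exists_inner_cross_normal
  obtain ⟨K₀, hK₀, hw₀⟩ : ∃ K : ℝ, 0 < K ∧ w₀ = _ := F.exists_inner_cross_vec
  have hκ := neg_pos.2 F.triple_mul_crossingSign
  have key₁ {v : E3} {X Y Z : ℝ} (hv : v = X • F.a + Y • F.b + Z • F.c) :
      ⟪v, n₁⟫ * ε = k₁ * -(triple F.a F.b F.c * crossingSign p i j) * Y := by
    rw [hn₁, hv, F.inner_frame_smul_comb_mul_crossingSign]
    ring
  have key₃ {v : E3} {X Y Z : ℝ} (hv : v = X • F.a + Y • F.b + Z • F.c) :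
      ⟪v, n₃⟫ * ε = k₃ * -(triple F.a F.b F.c * crossingSign p i j) * X := by
    rw [hn₃, hv, F.inner_frame_smul_comb_mul_crossingSign]
    ring
  have ha₁ : a₁ = _ * 1 := key₁ (X := 0) (Z := 0) (by rw [vec, F.hb]; module)
  have ha₂ : a₂ = _ * (1 - F.β) :=
    key₁ (X := -F.α) (Z := -F.γ) (by rw [vec, F.hb, F.he]; module)
  have hb₁ : b₁ = _ * 1 := key₃ (Y := 0) (Z := 0) (by rw [vec, F.ha]; module)
  have hb₂ : b₂ = _ * (1 - F.α) :=
    key₃ (Y := -F.β) (Z := -F.γ) (by rw [vec, F.ha, F.he]; module)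
  have hd₀ : d₀ = _ * -F.β :=
    key₁ (X := 1 - F.α) (Z := -F.γ) (by rw [vec, F.ha, F.he]; module)
  have hd₁ : d₁ = _ * -F.α :=
    key₃ (Y := 1 - F.β) (Z := -F.γ) (by rw [vec, F.hb, F.he]; module)
  have hκ₁ := mul_pos hk₁ hκ
  have hκ₃ := mul_pos hk₃ hκ
  have ha₁' : 0 < a₁ := by rw [ha₁, mul_one]; exact hκ₁
  have hb₁' : 0 < b₁ := by rw [hb₁, mul_one]; exact hκ₃
  have ha₂p : 0 < a₂ ↔ F.β < 1 := by rw [ha₂, mul_pos_iff_of_pos_left hκ₁, sub_pos]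
  have ha₂n : a₂ < 0 ↔ 1 < F.β := by rw [ha₂, PolygonalChain.mul_neg_iff_of_pos_left hκ₁, sub_neg]
  have hb₂p : 0 < b₂ ↔ F.α < 1 := by rw [hb₂, mul_pos_iff_of_pos_left hκ₃, sub_pos]
  have hb₂n : b₂ < 0 ↔ 1 < F.α := by rw [hb₂, PolygonalChain.mul_neg_iff_of_pos_left hκ₃, sub_neg]
  have hd₀p : 0 < d₀ ↔ F.β < 0 := by rw [hd₀, mul_pos_iff_of_pos_left hκ₁, neg_pos]
  have hd₀n : d₀ < 0 ↔ 0 < F.β := by rw [hd₀, PolygonalChain.mul_neg_iff_of_pos_left hκ₁, neg_lt_zero]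
  have hd₁p : 0 < d₁ ↔ F.α < 0 := by rw [hd₁, mul_pos_iff_of_pos_left hκ₃, neg_pos]
  have hd₁n : d₁ < 0 ↔ 0 < F.α := by rw [hd₁, PolygonalChain.mul_neg_iff_of_pos_left hκ₃, neg_lt_zero]
  have hwp : 0 < w ↔ 0 < F.γ * (F.α + F.β - (1 - F.γ)) := by
    rw [hw, mul_pos_iff_of_pos_left hK]
  have hwn : w < 0 ↔ F.γ * (F.α + F.β - (1 - F.γ)) < 0 := by
    rw [hw, PolygonalChain.mul_neg_iff_of_pos_left hK]
  have hw₀p : 0 < w₀ ↔ F.α * F.β < 0 := by rw [hw₀, mul_pos_iff_of_pos_left hK₀, neg_pos]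
  have hw₀n : w₀ < 0 ↔ 0 < F.α * F.β := by rw [hw₀, PolygonalChain.mul_neg_iff_of_pos_left hK₀, neg_lt_zero]
  clear_value n₁ n₂ n₃ n₄ u₁ u₂ u₃ w w₀ a₁ a₂ b₁ b₂ d₀ d₁
  refine ⟨F.directionProbability_projectionsCross hij hij', F.area_Q₃signed, ?_, ?_, ?_, ?_⟩
  · intro hε hw' hw₀'
    have hγ := F.neg_of_crossingSign_eq hε
    have hαβ : 1 - F.γ < F.α + F.β := by
      rw [← sub_pos]
      exact pos_of_mul_neg_right (hwn.1 hw') hγ.le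
    obtain ⟨hα, hβ⟩ : 0 < F.α ∧ 0 < F.β := by
      rcases mul_pos_iff.1 (hw₀n.1 hw₀') with h | h
      · exact h
      · linarith
    obtain ⟨c₁, c₂, c₃, c₄⟩ := F.isSphericalPolygon_of_neg hγ hα hβ hαβ hk₁ hk₃ hk₄ hl₁ hl₂ hl₃
      hn₁ hn₃ hn₄ hu₁ hu₂ hu₃
    rw [ha₂p, ha₂n, hb₂p, hb₂n]
    -- The first sign of each pair is always positive, so twelve of the sixteen cases are vacuous.
    have ha₁n := ha₁'.not_gt
    have hb₁n := hb₁'.not_gt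
    refine ⟨fun _ hβ _ hα => c₁ hα hβ, fun _ _ h => absurd h hb₁n, fun _ hβ _ hα => c₂ hα hβ,
      fun _ _ h => absurd h hb₁n, fun h => absurd h ha₁n, fun h => absurd h ha₁n,
      fun h => absurd h ha₁n, fun h => absurd h ha₁n, fun _ hβ _ hα => c₃ hα hβ,
      fun _ _ h => absurd h hb₁n, fun _ hβ _ hα => c₄ hα hβ, fun _ _ h => absurd h hb₁n,
      fun h => absurd h ha₁n, fun h => absurd h ha₁n, fun h => absurd h ha₁n,
      fun h => absurd h ha₁n⟩
  · intro hε h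
    have hγ := F.neg_of_crossingSign_eq hε
    refine F.Q₃_eq_empty hγ (h.imp (fun h => ?_) hw₀p.1)
    rw [← sub_neg]
    exact neg_of_mul_pos_right (hwp.1 h) hγ.le
  all_goals
    intro hε hw'
    have hγ := F.pos_of_crossingSign_eq hε
    have e₂ : -n₂ = k₂ • comb F.a F.b F.c 0 0 (-1) := by
      rw [hn₂, ← smul_neg, neg_comb, neg_zero]
    have e₁ : -n₁ = k₁ • comb F.a F.b F.c 0 1 0 := by
      rw [hn₁, ← smul_neg, neg_comb, neg_neg, neg_zero]
    have e₃ : -n₃ = k₃ • comb F.a F.b F.c 1 0 0 := by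
      rw [hn₃, ← smul_neg, neg_comb, neg_neg, neg_zero]
    have e₄ : -n₄ = k₄ • comb F.a F.b F.c 1 1 1 := by
      rw [hn₄, ← smul_neg, neg_comb, neg_neg]
    have f₁ := (neg_neg u₁).trans hu₁
    have f₂ := (neg_neg u₂).trans hu₂
    have f₃ := (neg_neg u₃).trans hu₃
    -- The sign of $\beta$ decides which of $Y > 0$ and $\gamma Y > \beta Z$ implies the other;
    -- likewise $\alpha$ for $X$, and below $w$ for the pair in $X + Y$.
    have YU (h : F.β < 0) (Y Z : ℝ) (hZ : Z < 0) :
        0 < F.γ * Y + -F.β * Z ↔ 0 < Y ∧ 0 < F.γ * Y - F.β * Z := by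
      have := mul_pos_of_neg_of_neg h hZ
      exact ⟨fun g => ⟨pos_of_mul_pos_right (a := F.γ) (by linarith) hγ.le, by linarith⟩,
        fun g => by linarith [g.2]⟩
    have YN (h : 0 < F.β) (Y Z : ℝ) (hZ : Z < 0) :
        0 < 1 * Y + 0 * Z ↔ 0 < Y ∧ 0 < F.γ * Y - F.β * Z := by
      have := mul_neg_of_pos_of_neg h hZ
      rw [one_mul, zero_mul, add_zero]
      exact ⟨fun g => ⟨g, by linarith [mul_pos hγ g]⟩, And.left⟩
    have XU (h : F.α < 0) (X Z : ℝ) (hZ : Z < 0) :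
        0 < F.γ * X + -F.α * Z ↔ 0 < X ∧ 0 < F.γ * X - F.α * Z := by
      have := mul_pos_of_neg_of_neg h hZ
      exact ⟨fun g => ⟨pos_of_mul_pos_right (a := F.γ) (by linarith) hγ.le, by linarith⟩,
        fun g => by linarith [g.2]⟩
    have XN (h : 0 < F.α) (X Z : ℝ) (hZ : Z < 0) :
        0 < 1 * X + 0 * Z ↔ 0 < X ∧ 0 < F.γ * X - F.α * Z := by
      have := mul_neg_of_pos_of_neg h hZ
      rw [one_mul, zero_mul, add_zero]
      exact ⟨fun g => ⟨g, by linarith [mul_pos hγ g]⟩, And.left⟩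
    rw [hd₀p, hd₀n, hd₁p, hd₁n]
  · have hαβ := neg_of_mul_neg_right (hwn.1 hw') hγ.le
    have XYU (X Y Z : ℝ) (hZ : Z < 0) :
        0 < F.γ * X + F.γ * Y + (1 - F.α - F.β) * Z ↔
          0 < X + Y + Z ∧ 0 < F.γ * X + F.γ * Y + (1 - F.α - F.β) * Z := by
      have := mul_pos_of_neg_of_neg hαβ hZ
      exact ⟨fun g => ⟨pos_of_mul_pos_right (a := F.γ) (by linarith) hγ.le, g⟩, And.right⟩
    exact ⟨fun hβ hα => F.isSphericalPolygon_of_pos hγ hk₂ hl₁ hl₂ hl₃ hγ hγ hγ e₂ f₁ f₂ f₃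
        (YU hβ) XYU (XU hα),
      fun hβ hα => F.isSphericalPolygon_of_pos hγ hk₂ hk₁ hl₂ hk₃ one_pos hγ one_pos e₂ e₁ f₂ e₃
        (YN hβ) XYU (XN hα),
      fun hβ hα => F.isSphericalPolygon_of_pos hγ hk₂ hk₁ hl₂ hl₃ one_pos hγ hγ e₂ e₁ f₂ f₃
        (YN hβ) XYU (XU hα),
      fun hβ hα => F.isSphericalPolygon_of_pos hγ hk₂ hl₁ hl₂ hk₃ hγ hγ one_pos e₂ f₁ f₂ e₃
        (YU hβ) XYU (XN hα)⟩
  · have hαβ := pos_of_mul_pos_right (hwp.1 hw') hγ.le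
    have XYN (X Y Z : ℝ) (hZ : Z < 0) :
        0 < 1 * X + 1 * Y + 1 * Z ↔
          0 < X + Y + Z ∧ 0 < F.γ * X + F.γ * Y + (1 - F.α - F.β) * Z := by
      have := mul_neg_of_pos_of_neg hαβ hZ
      rw [one_mul, one_mul, one_mul]
      exact ⟨fun g => ⟨g, by linarith [mul_pos hγ g]⟩, And.left⟩
    exact ⟨fun hβ hα => F.isSphericalPolygon_of_pos hγ hk₂ hl₁ hk₄ hl₃ hγ one_pos hγ e₂ f₁ e₄ f₃
        (YU hβ) XYN (XU hα),
      fun hβ hα => F.isSphericalPolygon_of_pos hγ hk₂ hk₁ hk₄ hk₃ one_pos one_pos one_pos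
        e₂ e₁ e₄ e₃ (YN hβ) XYN (XN hα),
      fun hβ hα => F.isSphericalPolygon_of_pos hγ hk₂ hk₁ hk₄ hl₃ one_pos one_pos hγ e₂ e₁ e₄ f₃
        (YN hβ) XYN (XU hα),
      fun hβ hα => F.isSphericalPolygon_of_pos hγ hk₂ hl₁ hk₄ hk₃ hγ one_pos one_pos e₂ f₁ e₄ e₃
        (YU hβ) XYN (XN hα)⟩
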